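/- Let $E$ be a countable subset of a group $(\mathcal E,\star)$ and let $(X(t))_{t\ge 0}$ be an irreducible and transient Markov chain on $E$ with substochastic transition matrix $p(x,y)$, $x,y\in E$. Add an absorbing state $\vartheta$ with $p(x,\vartheta)=1-\sum_{y\in E}p(x,y)$, so that $(X(t))$ is a Markov chain on $E\cup\{\vartheta\}$; let $\mathbb P_x,\mathbb E_x$ refer to the chain started at $x$, and put $\tau_\vartheta=\inf\{t\ge 1: X(t)=\vartheta\}$, $G(x,y)=\sum_{t\ge 0}\mathbb P_x(X(t)=y)$, $G\varphi(x)=\sum_{y\in E}G(x,y)\varphi(y)$ and $Q(x,y)=\mathbb P_x(X(t)=y\text{ for some }0<t<\infty)$. Suppose that $u\in E$ satisfies $E\star u\subset E$ and $$p(x\star u,y\star u)=p(x,y),\qquad x,y\in E.$$ Define $A_u\varphi(x)=\sum_{y\in E}a_u(x,y)\varphi(y)$, where $a_u(x,y)=p(x\star u,y)-p(x,y\star u^{-1})$ if $y\in E\star u$ and $a_u(x,y)=p(x\star u,y)$ otherwise, and let $\eta_u=\inf\{t\ge 1: X(t)\notin E\star u\}$. (1) For every function $h:E\to[0,\infty)$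 and every $y\in E$, with both sides in $[0,\infty]$, $$G A_u h(y)=\mathbb E_{y\star u}\bigl(h(X(\eta_u));\ \eta_u<\tau_\vartheta\bigr).$$ (2) Suppose moreover that the hitting probabilities are slowly varying along $u$, i.e. that, uniformly in $x\in E$, $$\lim_{n\to\infty}\frac1n\log Q(x,x\star u^{\star n})=\lim_{n\to\infty}\frac1n\log Q(x\star u^{\star n},x)=0,$$ where $\log 0=-\infty$. Let $h:E\to[0,\infty)$ be a harmonic function, that is, $h\not\equiv 0$ and $\sum_{y\in E}p(x,y)h(y)=h(x)$ for all $x\in E$. Then $h>0$ everywhere on $E$, and for every $x\in E$ the ratio $h(x)/h(x\star u)$ is equal to the probability that the $h$-transform $(X_h(t))$, i.e. the Markov chain on $E$ with transition probabilities $p(x,y)h(y)/h(x)$, started at $x\star u$, never exits from $E\star u$. -/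

import Mathlib

open MeasureTheory ProbabilityTheory Filter
open scoped ENNReal NNReal

noncomputable section

namespace KilledWalk

/-- The state space `E ∪ {ϑ}` is `Option E`, with `ϑ = none`; it carries the discrete
σ-algebra. -/
instance instMeasurableSpaceOption (E : Type*) : MeasurableSpace (Option E) := ⊤

/-- A substochastic matrix on `E`. -/
structure SubMatrix (E : Type*) where
  /-- the entries -/
  p : E → E → ℝ≥0∞
  /-- the row sums are at most one -/
  sum_le : ∀ x, ∑' y, p x y ≤ 1

namespace SubMatrix

variable {E : Type*}

/-- The transition weights on `E ∪ {ϑ}`: `ϑ` is absorbing and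
`p(x, ϑ) = 1 - ∑_{y ∈ E} p(x, y)`. -/
def weight (P : SubMatrix E) : Option E → Option E → ℝ≥0∞
  | some x, some y => P.p x y
  | some x, none => 1 - ∑' y, P.p x y
  | none, some _ => 0
  | none, none => 1

theorem tsum_option_eq (f : Option E → ℝ≥0∞) : ∑' s, f s = f none + ∑' y, f (some y) := by
  have h := (Equiv.optionEquivSumPUnit.{0} E).symm.tsum_eq f
  rw [← h, ENNReal.summable.tsum_sum ENNReal.summable]
  simp [add_comm]

theorem tsum_weight (P : SubMatrix E) (s : Option E) : ∑' t, P.weight s t = 1 := by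
  rw [tsum_option_eq]
  cases s with
  | none => simp [weight]
  | some x => simpa [weight] using tsub_add_cancel_of_le (P.sum_le x)

/-- The transition law from a state of `E ∪ {ϑ}`. -/
def step (P : SubMatrix E) (s : Option E) : PMF (Option E) :=
  ⟨P.weight s, by rw [← P.tsum_weight s]; exact ENNReal.summable.hasSum⟩

/-- The transition from the history up to time `n` to the state at time `n + 1`; only the
present state matters. -/
def stepKernel (P : SubMatrix E) (n : ℕ) :
    Kernel ((i : Finset.Iic n) → (fun _ : ℕ => Option E) i) ((fun _ : ℕ => Option E) (n + 1)) where
  toFun w := (P.step (w ⟨n, Finset.mem_Iic.2 le_rfl⟩)).toMeasure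
  measurable' := by
    have h : Measurable fun s : Option E => (P.step s).toMeasure := measurable_from_top
    exact h.comp (measurable_pi_apply _)

instance (P : SubMatrix E) (n : ℕ) : IsMarkovKernel (P.stepKernel n) :=
  ⟨fun w => PMF.toMeasure.isProbabilityMeasure (P.step (w ⟨n, Finset.mem_Iic.2 le_rfl⟩))⟩

/-- `ℙ_x`: the law, on the path space `ℕ → E ∪ {ϑ}`, of the Markov chain with transition
probabilities `p` started at `x ∈ E`. The process is `X(t)(ω) = ω t`. -/
def law (P : SubMatrix E) (x : E) : Measure (ℕ → Option E) :=
  Kernel.traj (X := fun _ : ℕ => Option E) P.stepKernel 0 (fun _ => some x)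

/-- The Green function `G(x, y) = ∑_{t ≥ 0} ℙ_x(X(t) = y)`. -/
def green (P : SubMatrix E) (x y : E) : ℝ≥0∞ :=
  ∑' t : ℕ, P.law x {ω | ω t = some y}

/-- `Gφ(x) = ∑_y G(x, y) φ(y)`. -/
def greenOp (P : SubMatrix E) (φ : E → ℝ≥0∞) (x : E) : ℝ≥0∞ :=
  ∑' y, P.green x y * φ y

/-- The hitting probability `Q(x, y) = ℙ_x(X(t) = y for some 0 < t < ∞)`. -/
def hit (P : SubMatrix E) (x y : E) : ℝ≥0∞ :=
  P.law x {ω | ∃ t : ℕ, 0 < t ∧ ω t = some y}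

/-- Any two states of `E` communicate. -/
def Irreducible (P : SubMatrix E) : Prop :=
  ∀ x y, ∃ t : ℕ, 0 < P.law x {ω | ω t = some y}

/-- Every state of `E` is transient. -/
def Transient (P : SubMatrix E) : Prop :=
  ∀ x, P.green x x < ∞

/-- A harmonic function: a function `h : E → ℝ₊`, not identically zero, with `Ph = h`. -/
structure IsHarmonic (P : SubMatrix E) (h : E → ℝ≥0) : Prop where
  ne_zero : h ≠ 0
  sum_eq : ∀ x, ∑' y, P.p x y * (h y : ℝ≥0∞) = (h x : ℝ≥0∞)

/-- The `h`-transform of the chain: the chain with transition probabilities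
`p_h(x, y) = p(x, y) h(y) / h(x)`. -/
def hTransform (P : SubMatrix E) (h : E → ℝ≥0) (hh : P.IsHarmonic h) : SubMatrix E where
  p x y := P.p x y * (h y : ℝ≥0∞) / (h x : ℝ≥0∞)
  sum_le x := by
    simp only [div_eq_mul_inv]
    rw [ENNReal.tsum_mul_right, hh.sum_eq x, ← div_eq_mul_inv]
    exact ENNReal.div_self_le_one

end SubMatrix

/-- The first time `t ≥ 1` at which the path is outside the subset `F` of `E` (the state `ϑ`
is outside of `F`); it is `⊤` if there is none. -/
def exitTime {E : Type*} (F : Set E) : (ℕ → Option E) → WithTop ℕ :=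
  hittingAfter (fun (t : ℕ) (ω : ℕ → Option E) => ω t) (some '' F)ᶜ 1

/-- `τ_ϑ`: the first time `t ≥ 1` at which the path is in `ϑ`; `⊤` if there is none. -/
def killTime {E : Type*} : (ℕ → Option E) → WithTop ℕ :=
  hittingAfter (fun (t : ℕ) (ω : ℕ → Option E) => ω t) {none} 1

/-- The extension of `h : E → ℝ₊` to `E ∪ {ϑ}` by `h(ϑ) = 0`. -/
def extendZero {E : Type*} (h : E → ℝ≥0) : Option E → ℝ≥0∞
  | some x => (h x : ℝ≥0∞)
  | none => 0

/-- `𝔼_x(h(X(η)), η < τ_ϑ)` where `η` is the exit time from `F`. -/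
def exitExpectation {E : Type*} (P : SubMatrix E) (F : Set E) (h : E → ℝ≥0) (x : E) : ℝ≥0∞ :=
  ∫⁻ ω in {ω | exitTime F ω < killTime ω}, extendZero h (ω ((exitTime F ω).untopD 0)) ∂(P.law x)

section Translation

variable {𝓔 : Type*} [Group 𝓔] {E : Set 𝓔} {u : 𝓔}

/-- `E ⋆ u ⊆ E`. -/
def TranslateSubset (E : Set 𝓔) (u : 𝓔) : Prop := ∀ x ∈ E, x * u ∈ E

/-- The map `x ↦ x ⋆ u` from `E` to `E`. -/
def shift (hE : TranslateSubset E u) (x : E) : E := ⟨x * u, hE x x.2⟩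

/-- `E ⋆ u`, as a subset of `E`. -/
def translate (hE : TranslateSubset E u) : Set E := Set.range (shift hE)

theorem TranslateSubset.pow (hE : TranslateSubset E u) (n : ℕ) : TranslateSubset E (u ^ n) := by
  induction n with
  | zero => intro x hx; simpa using hx
  | succ k ih => intro x hx; rw [pow_succ, ← mul_assoc]; exact hE _ (ih x hx)

open Classical in
/-- The matrix `a_u(x, y)`, equal to `p(x ⋆ u, y) - p(x, y ⋆ u⁻¹)` for `y ∈ E ⋆ u` (that is, for
`y ⋆ u⁻¹ ∈ E`) and to `p(x ⋆ u, y)` otherwise. The truncated subtraction of `ℝ≥0∞` is the true one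
whenever `p(x ⋆ u, y ⋆ u) ≥ p(x, y)` for all `x, y ∈ E`. -/
def aMatrix (P : SubMatrix E) (hE : TranslateSubset E u) (x y : E) : ℝ≥0∞ :=
  if hy : (y : 𝓔) * u⁻¹ ∈ E then P.p (shift hE x) y - P.p x ⟨y * u⁻¹, hy⟩
  else P.p (shift hE x) y

/-- `A_u φ(x) = ∑_y a_u(x, y) φ(y)`. -/
def aOp (P : SubMatrix E) (hE : TranslateSubset E u) (φ : E → ℝ≥0∞) (x : E) : ℝ≥0∞ :=
  ∑' y, aMatrix P hE x y * φ y

/-- The hitting probabilities are slowly varying along `u`: uniformly in `x ∈ E`,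
`(1/n) log Q(x, x ⋆ uⁿ) → 0` and `(1/n) log Q(x ⋆ uⁿ, x) → 0`. Here `log` takes values in the
extended reals, with `log 0 = -∞`. -/
def SlowlyVarying (P : SubMatrix E) (hE : TranslateSubset E u) : Prop :=
  ∀ ε : ℝ, 0 < ε → ∀ᶠ n : ℕ in atTop, ∀ x : E,
    (ENNReal.log (P.hit x (shift (hE.pow n) x)) / (n : EReal)).abs < ENNReal.ofReal ε ∧
    (ENNReal.log (P.hit (shift (hE.pow n) x) x) / (n : EReal)).abs < ENNReal.ofReal ε

end Translation

end KilledWalk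

end

open KilledWalk

noncomputable section
namespace KilledWalk
open Topology

/-! Write `σ x = x ⋆ u`. By invariance, the chain started at `σ x` and killed on leaving `E ⋆ u` is
the image under `σ` of the chain started at `x` (`taboo_range`). Invariance also cancels every entry
of `a_u` except the one-step exits from `E ⋆ u`, so summing over the exit time gives (1).

For (2), the same identity applied to the `h`-transform shows that it stays in `E ⋆ u` up to time
`n` with probability `Pⁿ(h ∘ σ)(x) / h(σ x)`. Since `h ∘ σ` is superharmonic, these numbers decrease
to `pull h (x) / h(σ x)`, where `pull h` is the greatest harmonic minorant of `h ∘ σ`. The claim is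
therefore `pull h = h` (`pull_eq_self`).

Beside `pull` stands `push`, the least harmonic majorant of the transported function `h ∘ σ⁻¹`, and
`f ≤ pull (push f)` for harmonic `f`. Slow variation gives, for each `a > 1` and all large `n`,
`pullⁿ f ≤ f ∘ σⁿ ≤ aⁿ f`. It also gives `pushⁿ f ≤ aⁿ f`, on writing `f` as an increasing limit of
potentials and comparing Green functions with poles `z` and `σⁿ z`. On the cone of harmonic
functions, a positive operator bounded by a multiple of the identity has its best bound governed by
its growth rate: `V² ≤ a²` forces `V ≤ a` (`IsCentral.le_of_comp_self_le`). Hence `pull f ≤ f` and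
`push f ≤ f`, and `f ≤ pull (push f) ≤ pull f ≤ f`. -/

instance instDiscreteMeasurableSpaceOption (E : Type*) : DiscreteMeasurableSpace (Option E) :=
  ⟨fun _ => trivial⟩

/-! ### Path laws and taboo probabilities -/

namespace SubMatrix

theorem measurableSet_stay {E : Type*} (D : ℕ → Set (Option E)) (n : ℕ) (S : Set (Option E)) :
    MeasurableSet {ω : ℕ → Option E | (∀ i < n, ω i ∈ D i) ∧ ω n ∈ S} := by
  have e : {ω : ℕ → Option E | (∀ i < n, ω i ∈ D i) ∧ ω n ∈ S}
      = (⋂ i, ⋂ _ : i < n, (fun ω => ω i) ⁻¹' D i) ∩ (fun ω => ω n) ⁻¹' S := by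
    ext ω; simp
  rw [e]
  exact (MeasurableSet.iInter fun i => MeasurableSet.iInter fun _ =>
    (measurable_pi_apply i) MeasurableSet.of_discrete).inter
      ((measurable_pi_apply n) MeasurableSet.of_discrete)

/-- The probability that the path stays in `D 0`, …, `D (n - 1)` and is in `s` at time `n`. -/
def taboo {E : Type*} (P : SubMatrix E) (D : ℕ → Set (Option E)) (x : E) (n : ℕ) (s : Option E) : ℝ≥0∞ :=
  P.law x {ω | (∀ i < n, ω i ∈ D i) ∧ ω n = s}

/-- Decomposition by the first hitting time. Time `0` is left unconstrained because `Q` counts only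
visits at positive times. -/
theorem hit_eq_tsum_taboo {E : Type*} (P : SubMatrix E) (x y : E) :
    P.hit x y = ∑' n, P.taboo (fun i => if i = 0 then Set.univ else {some y}ᶜ) x (n + 1)
      (some y) := by
  unfold hit taboo
  rw [← measure_iUnion]
  · congr 1
    ext ω
    simp only [Set.mem_ofPred_eq, Set.mem_iUnion]
    constructor
    · intro h
      classical
      refine ⟨Nat.find h - 1, ?_⟩
      have h1 := Nat.find_spec h
      have e : Nat.find h - 1 + 1 = Nat.find h := Nat.sub_add_cancel h1.1
      rw [e]
      refine ⟨fun i hi => ?_, h1.2⟩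
      have h2 := Nat.find_min h hi
      split_ifs with hi0
      · trivial
      · exact fun h3 => h2 ⟨Nat.pos_of_ne_zero hi0, h3⟩
    · rintro ⟨n, -, h⟩
      exact ⟨n + 1, Nat.succ_pos n, h⟩
  · intro m n hmn
    refine Set.disjoint_left.2 ?_
    rintro ω ⟨h1, h2⟩ ⟨h3, h4⟩
    rcases lt_or_gt_of_ne hmn with h | h
    · have := h3 (m + 1) (by omega)
      simp [h2] at this
    · have := h1 (n + 1) (by omega)
      simp [h4] at this
  · intro n
    exact measurableSet_stay _ _ {some y}

section Law

variable {E : Type*} [Countable E]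

instance (P : SubMatrix E) (x : E) : IsProbabilityMeasure (P.law x) := by
  unfold law; infer_instance

theorem lintegral_state {Ω : Type*} [MeasurableSpace Ω] (μ : Measure Ω) {X : Ω → Option E}
    (hX : Measurable X) {A : Set Ω} (g : Option E → ℝ≥0∞) :
    ∫⁻ ω in A, g (X ω) ∂μ = ∑' z, μ {ω | ω ∈ A ∧ X ω = z} * g z := by
  have h : ∫⁻ ω in A, g (X ω) ∂μ = ∫⁻ z, g z ∂((μ.restrict A).map X) :=
    (lintegral_map measurable_from_top hX).symm
  rw [h, lintegral_countable']
  refine tsum_congr fun z => ?_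
  rw [Measure.map_apply hX (MeasurableSet.singleton z),
    Measure.restrict_apply (hX (MeasurableSet.singleton z)), mul_comm]
  congr 2
  ext ω
  simp [and_comm]

/-- The Markov property at time `n`, for an arbitrary event of the history. It is the only place
where the construction of the path measure by kernels enters the transition step. -/
theorem law_succ (P : SubMatrix E) (x : E) (n : ℕ) (s : Option E)
    {B : Set ((i : Finset.Iic n) → (fun _ : ℕ => Option E) i)} (hB : MeasurableSet B) :
    P.law x {ω | Preorder.frestrictLe (π := fun _ : ℕ => Option E) n ω ∈ B ∧ ω (n + 1) = s}
      = ∑' z, P.law x {ω | Preorder.frestrictLe (π := fun _ : ℕ => Option E) n ω ∈ B ∧ ω n = z}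
          * P.weight z s := by
  have hf : Measurable (Preorder.frestrictLe (π := fun _ : ℕ => Option E) n) :=
    Preorder.measurable_frestrictLe n
  have h1 := Kernel.partialTraj_compProd_eq_map_traj (X := fun _ : ℕ => Option E)
    (κ := P.stepKernel) (Nat.zero_le n) (x₀ := fun _ => some x)
  have h2 := congrArg (fun μ => μ (B ×ˢ {s})) h1
  simp only at h2
  rw [Measure.compProd_apply_prod hB (MeasurableSet.singleton s),
    Measure.map_apply (by fun_prop) (hB.prod (MeasurableSet.singleton s)),
    ← Kernel.traj_map_frestrictLe_apply, setLIntegral_map hB (Kernel.measurable_coe _ (MeasurableSet.singleton s)) hf] at h2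
  have h3 : P.law x {ω | Preorder.frestrictLe (π := fun _ : ℕ => Option E) n ω ∈ B ∧ ω (n + 1) = s}
      = ∫⁻ ω in Preorder.frestrictLe (π := fun _ : ℕ => Option E) n ⁻¹' B,
          P.weight (ω n) s ∂(P.law x) := by
    refine (h2.symm.trans ?_)
    refine lintegral_congr fun ω => ?_
    change (P.step _).toMeasure {s} = _
    rw [PMF.toMeasure_apply_singleton _ _ (MeasurableSet.singleton s)]
    rfl
  rw [h3]
  exact lintegral_state (P.law x) (measurable_pi_apply n) (fun z => P.weight z s)

theorem law_zero (P : SubMatrix E) (x : E) : ∀ᵐ ω ∂(P.law x), ω 0 = some x := by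
  have h := Kernel.traj_map_frestrictLe_apply (X := fun _ : ℕ => Option E)
    (κ := P.stepKernel) 0 0 (fun _ => some x)
  have hs : MeasurableSet {w : (i : Finset.Iic 0) → (fun _ : ℕ => Option E) i |
      w ⟨0, Finset.mem_Iic.2 le_rfl⟩ = some x} := by
    have h0 : Measurable fun w : (i : Finset.Iic 0) → (fun _ : ℕ => Option E) i =>
        w ⟨0, Finset.mem_Iic.2 le_rfl⟩ := measurable_pi_apply _
    exact h0 (MeasurableSet.singleton (some x))
  rw [Kernel.partialTraj_self, Kernel.id_apply] at h
  have h2 : ∀ᵐ w ∂((Kernel.traj (X := fun _ : ℕ => Option E) P.stepKernel 0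
      (fun _ => some x)).map (Preorder.frestrictLe 0)),
      w ⟨0, Finset.mem_Iic.2 le_rfl⟩ = some x := by
    rw [h, ae_dirac_iff hs]
  exact ae_of_ae_map (by fun_prop) h2

open Classical in
theorem taboo_zero (P : SubMatrix E) (D : ℕ → Set (Option E)) (x : E) (s : Option E) :
    P.taboo D x 0 s = if s = some x then 1 else 0 := by
  unfold taboo
  split_ifs with h
  · rw [← prob_compl_eq_zero_iff]
    · filter_upwards [P.law_zero x] with ω hω
      simp [hω, h]
    · have h0 : Measurable fun ω : ℕ → Option E => ω 0 := measurable_pi_apply 0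
      convert h0 (MeasurableSet.singleton s) using 1
      ext ω; simp
  · refine measure_mono_null ?_ (P.law_zero x)
    intro ω hω
    simp only [Set.mem_ofPred_eq] at hω
    simp only [Set.mem_compl_iff, Set.mem_ofPred_eq]
    rw [hω.2]
    exact h

open Classical in
theorem taboo_succ (P : SubMatrix E) (D : ℕ → Set (Option E)) (x : E) (n : ℕ) (s : Option E) :
    P.taboo D x (n + 1) s
      = ∑' z, (if z ∈ D n then P.taboo D x n z else 0) * P.weight z s := by
  have hB : MeasurableSet {w : (i : Finset.Iic n) → (fun _ : ℕ => Option E) i |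
      ∀ i : Finset.Iic n, w i ∈ D i} := by
    simp only [Set.ofPred_forall]
    exact MeasurableSet.iInter fun i => (measurable_pi_apply i) (trivial : MeasurableSet (D i))
  have h := P.law_succ x n s hB
  have e : ∀ ω : ℕ → Option E, (Preorder.frestrictLe (π := fun _ : ℕ => Option E) n ω ∈
      {w : (i : Finset.Iic n) → (fun _ : ℕ => Option E) i | ∀ i : Finset.Iic n, w i ∈ D i})
      ↔ ∀ i < n + 1, ω i ∈ D i := by
    intro ω
    constructor
    · intro h i hi
      exact h ⟨i, Finset.mem_Iic.2 (Nat.lt_succ_iff.1 hi)⟩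
    · intro h i
      exact h i (Nat.lt_succ_iff.2 (Finset.mem_Iic.1 i.2))
  simp only [e] at h
  unfold taboo
  rw [h]
  refine tsum_congr fun z => ?_
  congr 1
  split_ifs with hz
  · congr 1
    ext ω
    simp only [Set.mem_ofPred_eq, Nat.lt_succ_iff_lt_or_eq]
    constructor
    · rintro ⟨a, b⟩
      exact ⟨fun i hi => a i (Or.inl hi), b⟩
    · rintro ⟨a, b⟩
      refine ⟨fun i hi => ?_, b⟩
      rcases hi with hi | rfl
      · exact a i hi
      · rwa [b]
  · convert measure_empty (μ := P.law x)
    ext ω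
    simp only [Set.mem_ofPred_eq, Set.mem_empty_iff_false, iff_false]
    rintro ⟨a, rfl⟩
    exact hz (a n (Nat.lt_succ_self n))

open Classical in
theorem taboo_succ_some (P : SubMatrix E) (D : ℕ → Set (Option E)) (x : E) (n : ℕ) (y : E) :
    P.taboo D x (n + 1) (some y)
      = ∑' z : E, (if some z ∈ D n then P.taboo D x n (some z) else 0) * P.p z y := by
  rw [taboo_succ, tsum_option_eq]
  simp [weight]

/-- The action `f ↦ Pf` of the matrix on functions. -/
def op (P : SubMatrix E) (f : E → ℝ≥0∞) (x : E) : ℝ≥0∞ := ∑' y, P.p x y * f y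

/-- This turns probabilities into powers of the operator `P`; the potential theory below works with
the latter only. -/
theorem tsum_law_mul (P : SubMatrix E) (x : E) (n : ℕ) (f : E → ℝ≥0∞) :
    ∑' z, P.law x {ω | ω n = some z} * f z = P.op^[n] f x := by
  classical
  have e : ∀ n z, P.law x {ω | ω n = some z} = P.taboo (fun _ => Set.univ) x n (some z) := by
    intro n z; simp [taboo]
  simp only [e]
  induction n generalizing f with
  | zero =>
    simp only [taboo_zero, Option.some.injEq, Function.iterate_zero, id]
    rw [tsum_eq_single x (by intro z hz; simp [hz])]
    simp
  | succ n ih =>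
    rw [Function.iterate_succ_apply, ← ih]
    simp only [taboo_succ_some, Set.mem_univ, if_true, op, ← ENNReal.tsum_mul_left,
      ← ENNReal.tsum_mul_right]
    rw [ENNReal.tsum_comm]
    simp only [mul_assoc]

theorem greenOp_eq (P : SubMatrix E) (φ : E → ℝ≥0∞) (x : E) :
    P.greenOp φ x = ∑' n, P.op^[n] φ x := by
  simp only [greenOp, green, ← tsum_law_mul, ← ENNReal.tsum_mul_right]
  rw [ENNReal.tsum_comm]

/-- A superharmonic function dominates its value at `y` times the probability to hit `y`. -/
theorem hit_mul_le (P : SubMatrix E) {f : E → ℝ≥0∞} (hf : ∀ x, P.op f x ≤ f x) (x y : E) :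
    P.hit x y * f y ≤ f x := by
  classical
  set D : ℕ → Set (Option E) := fun i => if i = 0 then Set.univ else {some y}ᶜ with hD
  -- Optional stopping: paths that have hit `y` are frozen with value `f y`, the others still carry
  -- `f` at their present state. Superharmonicity makes the total nonincreasing in `n`, and it
  -- starts at `f x`.
  have key : ∀ n, (∑ i ∈ Finset.range n, P.taboo D x (i + 1) (some y)) * f y
      + ∑' z : E, (if some z ∈ D n then P.taboo D x n (some z) else 0) * f z ≤ f x := by
    intro n
    induction n with
    | zero =>
      simp only [hD, Finset.range_zero, Finset.sum_empty, zero_mul, if_true, Set.mem_univ,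
        taboo_zero, Option.some.injEq, zero_add]
      rw [tsum_eq_single x (by intro z hz; simp [hz])]
      simp
    | succ n ih =>
      refine le_trans ?_ ih
      rw [Finset.sum_range_succ, add_mul, add_assoc]
      refine add_le_add le_rfl ?_
      calc P.taboo D x (n + 1) (some y) * f y
          + ∑' z : E, (if some z ∈ D (n + 1) then P.taboo D x (n + 1) (some z) else 0) * f z
          = ∑' z : E, P.taboo D x (n + 1) (some z) * f z := by
            rw [← tsum_ite_eq y fun _ => P.taboo D x (n + 1) (some y) * f y, ← ENNReal.tsum_add]
            refine tsum_congr fun z => ?_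
            have hz : some z ∈ D (n + 1) ↔ z ≠ y := by simp [hD]
            by_cases h : z = y
            · subst h; rw [if_pos rfl, if_neg (by simp [hz]), zero_mul, add_zero]
            · rw [if_neg h, if_pos (hz.2 h), zero_add]
        _ = ∑' z : E, (if some z ∈ D n then P.taboo D x n (some z) else 0) * P.op f z := by
            simp only [taboo_succ_some, op, ← ENNReal.tsum_mul_left, ← ENNReal.tsum_mul_right]
            rw [ENNReal.tsum_comm]
            simp only [mul_assoc]
        _ ≤ _ := by gcongr with z; exact hf z
  rw [hit_eq_tsum_taboo, ← ENNReal.tsum_mul_right, ENNReal.tsum_eq_iSup_nat]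
  refine iSup_le fun n => ?_
  rw [← Finset.sum_mul]
  exact le_self_add.trans (key n)

end Law

end SubMatrix
end KilledWalk
end
noncomputable section
namespace KilledWalk
open Topology
namespace SubMatrix

/-! ### The transition operator on nonnegative functions -/

section Op

variable {E : Type*}

theorem op_mono (P : SubMatrix E) : Monotone P.op := fun f g h x => by
  unfold op
  gcongr with y
  exact h y

theorem op_add (P : SubMatrix E) (f g : E → ℝ≥0∞) : P.op (f + g) = P.op f + P.op g := by
  funext x
  simp [op, mul_add, ENNReal.tsum_add]

theorem op_smul (P : SubMatrix E) (c : ℝ≥0∞) (f : E → ℝ≥0∞) : P.op (c • f) = c • P.op f := by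
  funext x
  simp [op, ← ENNReal.tsum_mul_left, mul_left_comm]

theorem op_tsum (P : SubMatrix E) {ι : Type*} (f : ι → E → ℝ≥0∞) :
    P.op (fun x => ∑' i, f i x) = fun x => ∑' i, P.op (f i) x := by
  funext x
  simp only [op, ← ENNReal.tsum_mul_left]
  rw [ENNReal.tsum_comm]

/-- Sums become integrals for counting measure, which makes monotone and dominated convergence
available for `P`. -/
theorem op_eq_lintegral (P : SubMatrix E) (f : E → ℝ≥0∞) (x : E) :
    P.op f x = @lintegral E ⊤ (@Measure.count E ⊤) fun y => P.p x y * f y := by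
  let _ : MeasurableSpace E := ⊤
  exact (lintegral_count' measurable_from_top).symm

theorem op_iSup (P : SubMatrix E) {f : ℕ → E → ℝ≥0∞} (hf : Monotone f) :
    P.op (fun x => ⨆ n, f n x) = fun x => ⨆ n, P.op (f n) x := by
  funext x
  let _ : MeasurableSpace E := ⊤
  simp only [op_eq_lintegral, ENNReal.mul_iSup]
  exact lintegral_iSup (fun n => measurable_from_top) fun m n h y => by
    dsimp only
    gcongr
    exact hf h y

theorem p_ne_top (P : SubMatrix E) (x y : E) : P.p x y ≠ ∞ :=
  ne_top_of_le_ne_top ENNReal.one_ne_top ((ENNReal.le_tsum y).trans (P.sum_le x))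

theorem op_iInf (P : SubMatrix E) {f : ℕ → E → ℝ≥0∞} (hf : Antitone f)
    (h0 : ∀ x, P.op (f 0) x ≠ ∞) :
    P.op (fun x => ⨅ n, f n x) = fun x => ⨅ n, P.op (f n) x := by
  funext x
  let _ : MeasurableSpace E := ⊤
  have h0 := h0 x
  rw [op_eq_lintegral] at h0
  simp only [op_eq_lintegral]
  rw [← lintegral_iInf (fun n => measurable_from_top) _ h0]
  · refine lintegral_congr fun y => ?_
    exact ENNReal.mul_iInf fun h => absurd h (P.p_ne_top x y)
  · intro m n h y
    dsimp only
    gcongr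
    exact hf h y

theorem op_iterate_add (P : SubMatrix E) (n : ℕ) (f g : E → ℝ≥0∞) :
    P.op^[n] (f + g) = P.op^[n] f + P.op^[n] g :=
  Function.Semiconj₂.iterate (fun f g => P.op_add f g) n f g

theorem op_iterate_smul (P : SubMatrix E) (n : ℕ) (c : ℝ≥0∞) (f : E → ℝ≥0∞) :
    P.op^[n] (c • f) = c • P.op^[n] f :=
  (Function.Semiconj.iterate_right (f := fun f : E → ℝ≥0∞ => c • f)
    (fun f => (P.op_smul c f).symm) n f).symm

theorem op_iterate_tsum (P : SubMatrix E) {ι : Type*} (n : ℕ) (f : ι → E → ℝ≥0∞) :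
    P.op^[n] (fun x => ∑' i, f i x) = fun x => ∑' i, P.op^[n] (f i) x := by
  induction n with
  | zero => rfl
  | succ n ih => simp only [Function.iterate_succ_apply', ih, op_tsum]

theorem op_iterate_iSup (P : SubMatrix E) (m : ℕ) {f : ℕ → E → ℝ≥0∞} (hf : Monotone f) :
    P.op^[m] (fun x => ⨆ n, f n x) = fun x => ⨆ n, P.op^[m] (f n) x := by
  induction m with
  | zero => rfl
  | succ m ih =>
    simp only [Function.iterate_succ_apply', ih]
    exact P.op_iSup fun a b h => P.op_mono.iterate m (hf h)

theorem op_iterate_le (P : SubMatrix E) {f : E → ℝ≥0∞} (hf : P.op f ≤ f) (n : ℕ) :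
    P.op^[n] f ≤ f := by
  induction n with
  | zero => exact le_rfl
  | succ n ih =>
    rw [Function.iterate_succ_apply']
    exact (P.op_mono ih).trans hf

theorem op_min_le (P : SubMatrix E) {f g : E → ℝ≥0∞} (hf : P.op f ≤ f) (hg : P.op g ≤ g) :
    P.op (f ⊓ g) ≤ f ⊓ g :=
  le_inf ((P.op_mono inf_le_left).trans hf) ((P.op_mono inf_le_right).trans hg)

theorem op_one_le (P : SubMatrix E) : P.op 1 ≤ 1 := fun x => by
  simpa [op] using P.sum_le x

/-- A superharmonic function whose averages tend to zero is the potential of its charge. -/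
theorem tsum_op_iterate_charge (P : SubMatrix E) {v : E → ℝ≥0∞} (hv : P.op v ≤ v)
    (hlim : ∀ x, Tendsto (fun n => P.op^[n] v x) atTop (𝓝 0)) (x : E) :
    ∑' n, P.op^[n] (v - P.op v) x = v x := by
  have h0 : v - P.op v + P.op v = v := tsub_add_cancel_of_le hv
  -- The partial sums telescope; the remainder `P^N v` vanishes in the limit.
  have h : ∀ N, ∑ n ∈ Finset.range N, P.op^[n] (v - P.op v) x + P.op^[N] v x = v x := by
    intro N
    induction N with
    | zero => simp
    | succ N ih =>
      rw [Finset.sum_range_succ, add_assoc, Function.iterate_succ_apply, ← Pi.add_apply,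
        ← op_iterate_add, h0, ih]
  have h1 := (ENNReal.tendsto_nat_tsum fun n => P.op^[n] (v - P.op v) x).add (hlim x)
  simp only [h, add_zero] at h1
  exact tendsto_nhds_unique h1 tendsto_const_nhds |>.symm ▸ rfl

open Classical in
theorem green_eq (P : SubMatrix E) (z : E) :
    (fun x => P.green x z) = P.greenOp (Pi.single z 1) := by
  funext x
  rw [greenOp, tsum_eq_single z (by intro y hy; simp [hy])]
  simp

end Op

/-! ### Green potentials and the domination principle -/

section Potential

variable {E : Type*} [Countable E]

theorem op_greenOp_add (P : SubMatrix E) (φ : E → ℝ≥0∞) :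
    φ + P.op (P.greenOp φ) = P.greenOp φ := by
  have e : P.greenOp φ = fun x => ∑' n, P.op^[n] φ x := funext fun x => P.greenOp_eq φ x
  rw [e, op_tsum]
  funext x
  rw [Pi.add_apply, tsum_eq_zero_add' (f := fun n => P.op^[n] φ x) ENNReal.summable]
  simp only [Function.iterate_succ_apply', Function.iterate_zero, id]

theorem op_greenOp_le (P : SubMatrix E) (φ : E → ℝ≥0∞) : P.op (P.greenOp φ) ≤ P.greenOp φ := by
  conv_rhs => rw [← op_greenOp_add]
  exact le_add_self

theorem tendsto_op_iterate_greenOp (P : SubMatrix E) {φ : E → ℝ≥0∞} {x : E}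
    (h : P.greenOp φ x ≠ ∞) : Tendsto (fun n => P.op^[n] (P.greenOp φ) x) atTop (𝓝 0) := by
  have e : P.greenOp φ = fun x => ∑' n, P.op^[n] φ x := funext fun x => P.greenOp_eq φ x
  rw [greenOp_eq] at h
  simp only [e, op_iterate_tsum, ← Function.iterate_add_apply]
  have := ENNReal.tendsto_sum_nat_add (fun n => P.op^[n] φ x) h
  simpa only [add_comm] using this

theorem op_green_le (P : SubMatrix E) (z : E) :
    P.op (fun x => P.green x z) ≤ fun x => P.green x z := by
  classical
  rw [green_eq]
  exact P.op_greenOp_le _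

theorem green_self (P : SubMatrix E) (z : E) :
    1 + P.op (fun x => P.green x z) z = P.green z z := by
  classical
  have h := congrFun (P.op_greenOp_add (Pi.single z 1)) z
  rw [← green_eq] at h
  simpa using h

theorem green_self_ne_zero (P : SubMatrix E) (z : E) : P.green z z ≠ 0 := by
  rw [← green_self]
  simp

/-- `G(·, z)` is superharmonic, so `ℙ_z(X(t) = x) G(x, z) ≤ G(z, z) < ∞`, and irreducibility makes
the first factor positive for some `t`. -/
theorem green_ne_top (P : SubMatrix E) (hirr : P.Irreducible) (htrans : P.Transient) (x z : E) :
    P.green x z ≠ ∞ := by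
  obtain ⟨t, ht⟩ := hirr z x
  have h1 := P.op_iterate_le (P.op_green_le z) t z
  rw [← tsum_law_mul] at h1
  have h2 := (ENNReal.le_tsum x).trans h1
  intro h
  rw [h, ENNReal.mul_top ht.ne', top_le_iff] at h2
  exact (htrans z).ne h2

/-- The domination principle. -/
theorem green_mul_le (P : SubMatrix E) (hirr : P.Irreducible) (htrans : P.Transient)
    {f : E → ℝ≥0∞} (hf : P.op f ≤ f) (hfin : ∀ x, f x ≠ ∞) (x z : E) :
    P.green x z * f z ≤ P.green z z * f x := by
  set g : E → ℝ≥0∞ := fun x => P.green x z with hg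
  -- The minimum is superharmonic and lies below a multiple of `G(·, z)`, so it is the potential of
  -- its charge. The constants make both functions agree at `z`.
  set v : E → ℝ≥0∞ := (f z • g) ⊓ (P.green z z • f) with hvdef
  have hgt : ∀ x, g x ≠ ∞ := fun x => P.green_ne_top hirr htrans x z
  have h1 : P.op (f z • g) ≤ f z • g := by
    rw [op_smul]
    exact fun y => mul_le_mul_right (P.op_green_le z y) _
  have h2 : P.op (P.green z z • f) ≤ P.green z z • f := by
    rw [op_smul]
    exact fun y => mul_le_mul_right (hf y) _
  have hv : P.op v ≤ v := P.op_min_le h1 h2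
  have hlim : ∀ y, Tendsto (fun n => P.op^[n] v y) atTop (𝓝 0) := by
    intro y
    classical
    have h3 : Tendsto (fun n => P.op^[n] g y) atTop (𝓝 0) := by
      have := hgt y
      rw [hg, green_eq] at this ⊢
      exact P.tendsto_op_iterate_greenOp this
    have h4 := ENNReal.Tendsto.const_mul (a := f z) h3 (Or.inr (hfin z))
    rw [mul_zero] at h4
    refine tendsto_of_tendsto_of_tendsto_of_le_of_le tendsto_const_nhds h4 (fun _ => zero_le) ?_
    intro n
    have := P.op_mono.iterate n (inf_le_left : v ≤ f z • g) y
    rwa [op_iterate_smul] at this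
  -- At `z` the charge of `v` is at least that of `f z • G(·, z)`, which has unit charge times `f z`
  -- there.
  have hφ : f z ≤ (v - P.op v) z := by
    have hvz : v z = f z * g z := by
      simp [hvdef, hg, mul_comm]
    have h5 : P.op v z ≤ f z * P.op g z := by
      have := P.op_mono (inf_le_left : v ≤ f z • g) z
      rwa [op_smul] at this
    have h6 : f z * P.op g z ≠ ∞ :=
      ENNReal.mul_ne_top (hfin z) (ne_top_of_le_ne_top (hgt z) (P.op_green_le z z))
    rw [Pi.sub_apply, hvz]
    refine le_trans ?_ (tsub_le_tsub_left h5 _)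
    have e : g z = 1 + P.op g z := (P.green_self z).symm
    rw [e, mul_add, mul_one, ENNReal.add_sub_cancel_right h6]
  calc P.green x z * f z ≤ P.green x z * (v - P.op v) z := by gcongr
    _ ≤ P.greenOp (v - P.op v) x := ENNReal.le_tsum z
    _ = v x := by rw [greenOp_eq, P.tsum_op_iterate_charge hv hlim]
    _ ≤ _ := inf_le_right

/-- The Green function normalized to be one on the diagonal. -/
def reach (P : SubMatrix E) (x z : E) : ℝ≥0∞ := P.green x z / P.green z z

theorem op_reach_le (P : SubMatrix E) (z : E) :
    P.op (fun x => P.reach x z) ≤ fun x => P.reach x z := by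
  have e : (fun x => P.reach x z) = (P.green z z)⁻¹ • fun x => P.green x z := by
    funext x
    simp [reach, div_eq_mul_inv, mul_comm]
  rw [e, op_smul]
  exact fun y => mul_le_mul_right (P.op_green_le z y) _

variable {P : SubMatrix E}

theorem reach_ne_top (hirr : P.Irreducible) (htrans : P.Transient) (x z : E) :
    P.reach x z ≠ ∞ :=
  ENNReal.div_ne_top (P.green_ne_top hirr htrans x z) (P.green_self_ne_zero z)

theorem reach_self (htrans : P.Transient) (z : E) : P.reach z z = 1 :=
  ENNReal.div_self (P.green_self_ne_zero z) (htrans z).ne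

/-- The domination principle in normalized form. Applied to `1`, to another `reach` and to shifted
ones, it yields all the Green function estimates used later. -/
theorem reach_mul_le (hirr : P.Irreducible) (htrans : P.Transient)
    {f : E → ℝ≥0∞} (hf : P.op f ≤ f) (hfin : ∀ x, f x ≠ ∞) (x z : E) :
    P.reach x z * f z ≤ f x := by
  have h := P.green_mul_le hirr htrans hf hfin x z
  rw [reach, div_eq_mul_inv, mul_right_comm, ← div_eq_mul_inv]
  exact ENNReal.div_le_of_le_mul (by rwa [mul_comm (f x)])

theorem reach_le_one (hirr : P.Irreducible) (htrans : P.Transient) (x z : E) :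
    P.reach x z ≤ 1 := by
  simpa using reach_mul_le hirr htrans P.op_one_le (by simp) x z

theorem reach_mul_reach_le (hirr : P.Irreducible) (htrans : P.Transient) (x y z : E) :
    P.reach x y * P.reach y z ≤ P.reach x z :=
  reach_mul_le hirr htrans (P.op_reach_le z) (fun x => reach_ne_top hirr htrans x z) x y

theorem hit_le_reach (htrans : P.Transient) (x z : E) : P.hit x z ≤ P.reach x z := by
  simpa [reach_self htrans] using P.hit_mul_le (P.op_reach_le z) x z

/-- The weights `δ z / G(z, z)` with `δ` summable give a finite potential, because `G(x, z) / G(z,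
z) ≤ 1`. Its multiples serve to truncate superharmonic functions to potentials. -/
theorem exists_pos_potential (hirr : P.Irreducible) (htrans : P.Transient) :
    ∃ v : E → ℝ≥0∞, P.op v ≤ v ∧ (∀ x, v x ≠ 0) ∧ (∀ x, v x ≠ ∞) ∧
      ∀ x, Tendsto (fun n => P.op^[n] v x) atTop (𝓝 0) := by
  obtain ⟨δ, hδ, hsum⟩ := ENNReal.exists_pos_sum_of_countable' one_ne_zero E
  have hle : ∀ x, P.greenOp (fun z => δ z / P.green z z) x ≠ ∞ := by
    intro x
    refine ne_top_of_le_ne_top ENNReal.one_ne_top (le_trans ?_ hsum.le)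
    unfold greenOp
    gcongr with z
    calc P.green x z * (δ z / P.green z z) = P.reach x z * δ z := by
          simp only [reach, div_eq_mul_inv]; ring
      _ ≤ 1 * δ z := by gcongr; exact reach_le_one hirr htrans x z
      _ = δ z := one_mul _
  refine ⟨_, P.op_greenOp_le _, fun x => ?_, hle, fun x => P.tendsto_op_iterate_greenOp (hle x)⟩
  have h : δ x ≤ P.greenOp (fun z => δ z / P.green z z) x := by
    refine le_trans ?_ (ENNReal.le_tsum x)
    rw [ENNReal.mul_div_cancel (P.green_self_ne_zero x) (htrans x).ne]
  exact ((hδ x).trans_le h).ne'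

/-- A finite superharmonic function is an increasing limit of potentials. -/
theorem exists_charges (hirr : P.Irreducible) (htrans : P.Transient)
    {f : E → ℝ≥0∞} (hf : P.op f ≤ f) (hfin : ∀ x, f x ≠ ∞) :
    ∃ ρ : ℕ → E → ℝ≥0∞, Monotone (fun k x => ∑' z, P.reach x z * ρ k z) ∧
      f = fun x => ⨆ k, ∑' z, P.reach x z * ρ k z := by
  obtain ⟨v, hv, hpos, hvfin, hlim⟩ := exists_pos_potential hirr htrans
  -- Each truncation is superharmonic and dominated by a potential, hence itself a potential. The
  -- truncations increase to `f` because `v > 0` and `f < ∞`.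
  set w : ℕ → E → ℝ≥0∞ := fun k => f ⊓ ((k : ℝ≥0∞) • v) with hw
  have hwsup : ∀ k, P.op (w k) ≤ w k := fun k => P.op_min_le hf (by
    rw [op_smul]
    exact fun y => mul_le_mul_right (hv y) _)
  have hwlim : ∀ k x, Tendsto (fun n => P.op^[n] (w k) x) atTop (𝓝 0) := by
    intro k x
    have h4 := ENNReal.Tendsto.const_mul (a := (k : ℝ≥0∞)) (hlim x)
      (Or.inr (ENNReal.natCast_ne_top k))
    rw [mul_zero] at h4
    refine tendsto_of_tendsto_of_tendsto_of_le_of_le tendsto_const_nhds h4 (fun _ => zero_le) ?_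
    intro n
    have := P.op_mono.iterate n (inf_le_right : w k ≤ (k : ℝ≥0∞) • v) x
    rwa [op_iterate_smul] at this
  have e : ∀ k x, ∑' z, P.reach x z * (P.green z z * (w k - P.op (w k)) z) = w k x := by
    intro k x
    rw [← P.tsum_op_iterate_charge (hwsup k) (hwlim k), ← greenOp_eq]
    refine tsum_congr fun z => ?_
    rw [← mul_assoc, reach, ENNReal.div_mul_cancel (P.green_self_ne_zero z) (htrans z).ne]
  refine ⟨fun k z => P.green z z * (w k - P.op (w k)) z, ?_, ?_⟩
  · simp only [e]
    intro a b h x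
    refine inf_le_inf_left _ ?_
    change (a : ℝ≥0∞) * v x ≤ b * v x
    gcongr
  · simp only [e]
    funext x
    refine le_antisymm ?_ (iSup_le fun k => inf_le_left)
    obtain ⟨k, hk⟩ := ENNReal.exists_nat_mul_gt (hpos x) (hfin x)
    exact le_iSup_of_le k (le_inf le_rfl hk.le)

end Potential

end SubMatrix
end KilledWalk
end
noncomputable section
namespace KilledWalk
open Topology
namespace SubMatrix

/-! ### Positive operators on the harmonic cone -/

section PositiveOperator

variable {E : Type*}

/-- The finite nonnegative functions `f` with `Pf = f`, the zero function included. -/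
def harmonicCone (P : SubMatrix E) : Set (E → ℝ≥0∞) := {f | (∀ x, f x ≠ ∞) ∧ P.op f = f}

/-- A positive operator on the cone of harmonic functions which is bounded by a multiple of the
identity. -/
structure IsCentral (P : SubMatrix E) (V : (E → ℝ≥0∞) → E → ℝ≥0∞) : Prop where
  op_map : ∀ f ∈ P.harmonicCone, P.op (V f) = V f
  add : ∀ f ∈ P.harmonicCone, ∀ g ∈ P.harmonicCone, V (f + g) = V f + V g
  smul : ∀ c : ℝ≥0, c ≠ 0 → ∀ f ∈ P.harmonicCone, V ((c : ℝ≥0∞) • f) = (c : ℝ≥0∞) • V f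
  bdd : ∃ c : ℝ≥0, ∀ f ∈ P.harmonicCone, V f ≤ (c : ℝ≥0∞) • f

variable {P : SubMatrix E} {V : (E → ℝ≥0∞) → E → ℝ≥0∞}

theorem smul_mem_harmonicCone {f : E → ℝ≥0∞} (hf : f ∈ P.harmonicCone) (c : ℝ≥0) :
    (c : ℝ≥0∞) • f ∈ P.harmonicCone :=
  ⟨fun x => ENNReal.mul_ne_top ENNReal.coe_ne_top (hf.1 x), by rw [op_smul, hf.2]⟩

theorem sub_mem_harmonicCone {f g : E → ℝ≥0∞} (hf : f ∈ P.harmonicCone)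
    (hg : g ∈ P.harmonicCone) (h : g ≤ f) : f - g ∈ P.harmonicCone := by
  refine ⟨fun x => ne_top_of_le_ne_top (hf.1 x) tsub_le_self, ?_⟩
  have h1 : P.op (f - g) + g = f := by
    conv_lhs => rw [← hg.2]
    rw [hg.2, ← hf.2]
    conv_rhs => rw [← tsub_add_cancel_of_le h, op_add, hg.2]
    rw [hf.2]
  funext x
  have h2 := congrFun h1 x
  exact ENNReal.eq_sub_of_add_eq (hg.1 x) h2

theorem IsCentral.mem (hV : P.IsCentral V) {f : E → ℝ≥0∞} (hf : f ∈ P.harmonicCone) :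
    V f ∈ P.harmonicCone := by
  obtain ⟨c, hc⟩ := hV.bdd
  exact ⟨fun x => ne_top_of_le_ne_top (ENNReal.mul_ne_top ENNReal.coe_ne_top (hf.1 x))
    (hc f hf x), hV.op_map f hf⟩

theorem IsCentral.comp_self (hV : P.IsCentral V) : P.IsCentral (V ∘ V) where
  op_map f hf := hV.op_map _ (hV.mem hf)
  add f hf g hg := by
    simp only [Function.comp, hV.add f hf g hg, hV.add _ (hV.mem hf) _ (hV.mem hg)]
  smul c hc f hf := by
    simp only [Function.comp, hV.smul c hc f hf, hV.smul c hc _ (hV.mem hf)]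
  bdd := by
    obtain ⟨c, hc⟩ := hV.bdd
    refine ⟨c * c, fun f hf x => ((hc _ (hV.mem hf) x).trans
      (mul_le_mul_right (hc f hf x) _)).trans_eq ?_⟩
    simp [mul_assoc]

/-- If the square of a central operator is bounded by `a ^ 2`, the operator is bounded by `a`. -/
theorem IsCentral.le_of_comp_self_le (hV : P.IsCentral V) {a : ℝ≥0}
    (ha : ∀ f ∈ P.harmonicCone, V (V f) ≤ ((a ^ 2 : ℝ≥0) : ℝ≥0∞) • f) :
    ∀ f ∈ P.harmonicCone, V f ≤ (a : ℝ≥0∞) • f := by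
  set A : Set ℝ≥0 := {c | ∀ f ∈ P.harmonicCone, V f ≤ (c : ℝ≥0∞) • f} with hA
  -- Closedness makes the optimal constant `c = sInf A` itself a bound.
  have hclosed : IsClosed A := by
    have e : A = ⋂ f ∈ P.harmonicCone, ⋂ x, {c : ℝ≥0 | V f x ≤ (c : ℝ≥0∞) * f x} := by
      ext c
      simp [hA, Pi.le_def]
    rw [e]
    refine isClosed_biInter fun f hf => isClosed_iInter fun x => ?_
    exact isClosed_le continuous_const
      ((ENNReal.continuous_mul_const (hf.1 x)).comp ENNReal.continuous_coe)
  have hne : A.Nonempty := hV.bdd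
  set c := sInf A
  have hc : c ∈ A := hclosed.csInf_mem hne (OrderBot.bddBelow A)
  have hca : c ≤ a := by
    rcases eq_or_ne c 0 with h0 | h0
    · simp [h0]
    -- Applying `V ≤ c` to the harmonic function `cf - Vf` gives `cVf - V²f ≤ c²f - cVf`, so `2cVf ≤
    -- c²f + V²f ≤ (c² + a²)f`. Minimality then gives `c ≤ (a² + c²) / (2c)`, that is `c² ≤ a²`.
    have key : (a ^ 2 + c ^ 2) / (2 * c) ∈ A := by
      intro f hf x
      have hg : (c : ℝ≥0∞) • f - V f ∈ P.harmonicCone :=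
        sub_mem_harmonicCone (smul_mem_harmonicCone hf c) (hV.mem hf) (hc f hf)
      have hadd : (c : ℝ≥0∞) • f - V f + V f = (c : ℝ≥0∞) • f := tsub_add_cancel_of_le (hc f hf)
      have h1 := congrFun (hV.add _ hg _ (hV.mem hf)) x
      rw [hadd, hV.smul c h0 f hf] at h1
      have h2 := hc _ hg x
      have h3 := congrFun hadd x
      have h4 := ha f hf x
      have hVV := (hV.mem (hV.mem hf)).1 x
      have hVf := (hV.mem hf).1 x
      have hVg := (hV.mem hg).1 x
      have hgx := hg.1 x
      have hfx := hf.1 x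
      simp only [Pi.smul_apply, Pi.add_apply, smul_eq_mul] at h1 h2 h3 h4 ⊢
      lift V (V f) x to ℝ≥0 using hVV with p hp
      lift V f x to ℝ≥0 using hVf with q hq
      lift V ((c : ℝ≥0∞) • f - V f) x to ℝ≥0 using hVg with r hr
      lift ((c : ℝ≥0∞) • f - V f) x to ℝ≥0 using hgx with s hs
      lift f x to ℝ≥0 using hfx with t ht
      norm_cast at h1 h2 h3 h4 ⊢
      rw [div_mul_eq_mul_div, le_div_iff₀ (by positivity)]
      rw [← NNReal.coe_le_coe] at h2 h4 ⊢
      rw [← NNReal.coe_inj] at h1 h3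
      push_cast at *
      have h5 : (c : ℝ) * (s + q) = c * (c * t) := by rw [h3]
      nlinarith
    have h1 : c ≤ (a ^ 2 + c ^ 2) / (2 * c) := csInf_le (OrderBot.bddBelow A) key
    rw [le_div_iff₀ (by positivity)] at h1
    have h2 : c ^ 2 ≤ a ^ 2 := by
      rw [← NNReal.coe_le_coe] at h1 ⊢
      push_cast at *
      nlinarith
    exact (pow_le_pow_iff_left₀ zero_le zero_le two_ne_zero).1 h2
  intro f hf
  refine (hc f hf).trans fun x => ?_
  change (c : ℝ≥0∞) * f x ≤ a * f x
  gcongr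

/-- Repeated square roots: the induction hypothesis is applied to `V ∘ V` with `a ^ 2`, and the
squaring lemma then descends to `V`. -/
theorem IsCentral.le_of_iterate_le (k : ℕ) : ∀ {V : (E → ℝ≥0∞) → E → ℝ≥0∞}, P.IsCentral V →
    ∀ {a : ℝ≥0}, (∀ f ∈ P.harmonicCone, V^[2 ^ k] f ≤ ((a ^ 2 ^ k : ℝ≥0) : ℝ≥0∞) • f) →
    ∀ f ∈ P.harmonicCone, V f ≤ (a : ℝ≥0∞) • f := by
  induction k with
  | zero => intro V hV a h; simpa using h
  | succ k ih =>
    intro V hV a h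
    refine hV.le_of_comp_self_le (a := a) ?_
    refine ih hV.comp_self (a := a ^ 2) fun f hf => ?_
    have e : (V ∘ V)^[2 ^ k] = V^[2 ^ (k + 1)] := by
      rw [pow_succ', Function.iterate_mul]
      rfl
    rw [e, ← pow_mul, ← pow_succ']
    exact h f hf

/-- Subexponential growth of the iterates is needed only along the powers of two; then `a` decreases
to `1`. -/
theorem IsCentral.le_self (hV : P.IsCentral V)
    (h : ∀ a : ℝ≥0, 1 < a → ∀ᶠ n : ℕ in atTop, ∀ f ∈ P.harmonicCone,
      V^[n] f ≤ ((a ^ n : ℝ≥0) : ℝ≥0∞) • f) :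
    ∀ f ∈ P.harmonicCone, V f ≤ f := by
  intro f hf x
  have h1 : ∀ a : ℝ≥0, 1 < a → V f x ≤ (a : ℝ≥0∞) * f x := by
    intro a ha
    obtain ⟨k, hk⟩ := ((tendsto_pow_atTop_atTop_of_one_lt (one_lt_two (α := ℕ))).eventually
      (h a ha)).exists
    exact IsCentral.le_of_iterate_le k hV hk f hf x
  have h2 : Tendsto (fun a : ℝ≥0 => (a : ℝ≥0∞) * f x) (𝓝[>] 1) (𝓝 (((1 : ℝ≥0) : ℝ≥0∞) * f x)) :=
    (((ENNReal.continuous_mul_const (hf.1 x)).comp ENNReal.continuous_coe).tendsto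
      1).mono_left nhdsWithin_le_nhds
  rw [ENNReal.coe_one, one_mul] at h2
  refine ge_of_tendsto h2 ?_
  filter_upwards [self_mem_nhdsWithin] with a ha using h1 a ha

theorem IsHarmonic.mem_harmonicCone {h : E → ℝ≥0} (hh : P.IsHarmonic h) :
    (fun y => (h y : ℝ≥0∞)) ∈ P.harmonicCone :=
  ⟨fun _ => ENNReal.coe_ne_top, funext hh.sum_eq⟩

end PositiveOperator

end SubMatrix
end KilledWalk
end
noncomputable section
namespace KilledWalk
open Topology
namespace SubMatrix

/-! ### Transport of harmonic functions along the shift -/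

section Shift

variable {E : Type*} {P : SubMatrix E} {σ : E → E}

/-- The transition matrix is invariant under the injection `σ`. -/
structure IsInvariant (P : SubMatrix E) (σ : E → E) : Prop where
  injective : Function.Injective σ
  p_map : ∀ x y, P.p (σ x) (σ y) = P.p x y

/-- The hitting probabilities along the orbits of `σ` decay subexponentially, uniformly. -/
def SlowHitting (P : SubMatrix E) (σ : E → E) : Prop :=
  ∀ a : ℝ≥0, 1 < a → ∀ᶠ n : ℕ in atTop, ∀ x : E,
    1 ≤ ((a ^ n : ℝ≥0) : ℝ≥0∞) * P.hit x (σ^[n] x) ∧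
    1 ≤ ((a ^ n : ℝ≥0) : ℝ≥0∞) * P.hit (σ^[n] x) x

/-- The left side is the part of the sum at `σ x` that runs over the range of `σ`; the steps leaving
that range are lost. -/
theorem IsInvariant.op_comp_le (hσ : P.IsInvariant σ) (f : E → ℝ≥0∞) :
    P.op (f ∘ σ) ≤ P.op f ∘ σ := fun x => by
  simp only [op, Function.comp, ← hσ.p_map x]
  exact ENNReal.tsum_comp_le_tsum_of_injective hσ.injective fun y => P.p (σ x) y * f y

theorem IsInvariant.op_comp_le_of_le (hσ : P.IsInvariant σ) {f : E → ℝ≥0∞} (hf : P.op f ≤ f) :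
    P.op (f ∘ σ) ≤ f ∘ σ :=
  (hσ.op_comp_le f).trans fun x => hf (σ x)

theorem IsInvariant.extend_apply (hσ : P.IsInvariant σ) (f : E → ℝ≥0∞) (x : E) :
    Function.extend σ f 0 (σ x) = f x :=
  hσ.injective.extend_apply f 0 x

theorem IsInvariant.extend_le_iff (hσ : P.IsInvariant σ) {f g : E → ℝ≥0∞} :
    Function.extend σ f 0 ≤ g ↔ f ≤ g ∘ σ := by
  constructor
  · intro h x
    rw [← hσ.extend_apply f x]
    exact h (σ x)
  · intro h y
    by_cases hy : ∃ x, σ x = y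
    · obtain ⟨x, rfl⟩ := hy
      rw [hσ.extend_apply]
      exact h x
    · rw [Function.extend_apply' _ _ _ hy]
      exact zero_le

theorem IsInvariant.op_extend_apply (hσ : P.IsInvariant σ) (f : E → ℝ≥0∞) (x : E) :
    P.op (Function.extend σ f 0) (σ x) = P.op f x := by
  unfold op
  rw [← hσ.injective.tsum_eq (f := fun y => P.p (σ x) y * Function.extend σ f 0 y)]
  · simp only [hσ.extend_apply, hσ.p_map]
  · intro y hy
    by_contra h
    apply hy
    simp only
    rw [Function.extend_apply' _ _ _ h, Pi.zero_apply, mul_zero]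

theorem IsInvariant.extend_le_op_extend (hσ : P.IsInvariant σ) {f : E → ℝ≥0∞}
    (hf : P.op f = f) : Function.extend σ f 0 ≤ P.op (Function.extend σ f 0) := by
  rw [hσ.extend_le_iff]
  intro x
  rw [Function.comp, hσ.op_extend_apply, hf]

/-- The greatest harmonic minorant of `f ∘ σ`, for harmonic `f`. -/
def pull (P : SubMatrix E) (σ : E → E) (f : E → ℝ≥0∞) (x : E) : ℝ≥0∞ :=
  ⨅ n, P.op^[n] (f ∘ σ) x

/-- The least harmonic majorant of the extension by zero of `f ∘ σ⁻¹`, for harmonic `f`. -/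
def push (P : SubMatrix E) (σ : E → E) (f : E → ℝ≥0∞) (x : E) : ℝ≥0∞ :=
  ⨆ n, P.op^[n] (Function.extend σ f 0) x

theorem pull_mono (P : SubMatrix E) (σ : E → E) : Monotone (P.pull σ) := fun _ _ h _ =>
  iInf_mono fun n => P.op_mono.iterate n (fun x => h (σ x)) _

theorem extend_mono (σ : E → E) : Monotone fun f : E → ℝ≥0∞ => Function.extend σ f 0 := by
  intro f g h y
  simp only [Function.extend]
  split_ifs
  · exact h _
  · exact le_rfl

theorem push_mono (P : SubMatrix E) (σ : E → E) : Monotone (P.push σ) := fun _ _ h _ =>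
  iSup_mono fun n => P.op_mono.iterate n (extend_mono σ h) _

theorem pull_le (P : SubMatrix E) (σ : E → E) (f : E → ℝ≥0∞) : P.pull σ f ≤ f ∘ σ :=
  fun _ => iInf_le_of_le 0 le_rfl

theorem pull_iterate_le (P : SubMatrix E) (σ : E → E) (n : ℕ) (f : E → ℝ≥0∞) :
    (P.pull σ)^[n] f ≤ f ∘ σ^[n] := by
  induction n with
  | zero => exact le_rfl
  | succ n ih =>
    rw [Function.iterate_succ_apply']
    refine (P.pull_le σ _).trans fun x => ?_
    rw [Function.comp, Function.comp, Function.iterate_succ_apply]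
    exact ih (σ x)

theorem extend_le_push (P : SubMatrix E) (σ : E → E) (f : E → ℝ≥0∞) :
    Function.extend σ f 0 ≤ P.push σ f :=
  fun x => le_iSup (fun n => P.op^[n] (Function.extend σ f 0) x) 0

theorem push_le (hσ : P.IsInvariant σ) {f g : E → ℝ≥0∞} (hg : P.op g ≤ g) (h : f ≤ g ∘ σ) :
    P.push σ f ≤ g := fun x => iSup_le fun n =>
  (P.op_mono.iterate n (hσ.extend_le_iff.2 h) x).trans (P.op_iterate_le hg n x)

theorem antitone_op_iterate_comp (hσ : P.IsInvariant σ) {f : E → ℝ≥0∞} (hf : P.op f ≤ f) :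
    Antitone fun n => P.op^[n] (f ∘ σ) :=
  antitone_nat_of_succ_le fun n => by
    rw [Function.iterate_succ_apply]
    exact P.op_mono.iterate n (hσ.op_comp_le_of_le hf)

theorem monotone_op_iterate_extend (hσ : P.IsInvariant σ) {f : E → ℝ≥0∞} (hf : P.op f = f) :
    Monotone fun n => P.op^[n] (Function.extend σ f 0) :=
  monotone_nat_of_le_succ fun n => by
    rw [Function.iterate_succ_apply]
    exact P.op_mono.iterate n (hσ.extend_le_op_extend hf)

/-- Dominated convergence along a decreasing sequence, with the finite function `f ∘ σ` as
dominating term. -/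
theorem op_pull (hσ : P.IsInvariant σ) {f : E → ℝ≥0∞} (hf : f ∈ P.harmonicCone) :
    P.op (P.pull σ f) = P.pull σ f := by
  have ha := antitone_op_iterate_comp hσ hf.2.le
  have h := P.op_iInf ha fun x => ne_top_of_le_ne_top (hf.1 (σ x))
    (hσ.op_comp_le_of_le hf.2.le x)
  have e : P.pull σ f = fun x => ⨅ n, P.op^[n] (f ∘ σ) x := rfl
  rw [e, h]
  funext x
  simp only [← Function.iterate_succ_apply' P.op]
  refine le_antisymm (le_iInf fun n => iInf_le_of_le n (ha n.le_succ x)) ?_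
  exact le_iInf fun n => iInf_le (fun n => P.op^[n] (f ∘ σ) x) (n + 1)

theorem op_push (hσ : P.IsInvariant σ) {f : E → ℝ≥0∞} (hf : P.op f = f) :
    P.op (P.push σ f) = P.push σ f := by
  have ha := monotone_op_iterate_extend hσ hf
  have h := P.op_iSup ha
  have e : P.push σ f = fun x => ⨆ n, P.op^[n] (Function.extend σ f 0) x := rfl
  rw [e, h]
  funext x
  simp only [← Function.iterate_succ_apply' P.op]
  refine le_antisymm ?_ (iSup_le fun n => le_iSup_of_le n (ha n.le_succ x))
  exact iSup_le fun n => le_iSup (fun n => P.op^[n] (Function.extend σ f 0) x) (n + 1)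

theorem pull_add (hσ : P.IsInvariant σ) {f g : E → ℝ≥0∞} (hf : P.op f ≤ f) (hg : P.op g ≤ g) :
    P.pull σ (f + g) = P.pull σ f + P.pull σ g := by
  funext x
  simp only [pull, Pi.add_apply]
  rw [ENNReal.iInf_add_iInf]
  · refine iInf_congr fun n => ?_
    rw [← Pi.add_apply, ← op_iterate_add]
    rfl
  · intro i j
    exact ⟨max i j, add_le_add (antitone_op_iterate_comp hσ hf (le_max_left i j) x)
      (antitone_op_iterate_comp hσ hg (le_max_right i j) x)⟩

theorem extend_add (σ : E → E) (f g : E → ℝ≥0∞) :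
    Function.extend σ (f + g) 0 = Function.extend σ f 0 + Function.extend σ g 0 := by
  funext y
  simp only [Function.extend, Pi.add_apply]
  split_ifs <;> simp

theorem extend_smul (σ : E → E) (c : ℝ≥0∞) (f : E → ℝ≥0∞) :
    Function.extend σ (c • f) 0 = c • Function.extend σ f 0 := by
  funext y
  simp only [Function.extend, Pi.smul_apply]
  split_ifs <;> simp

theorem push_add (hσ : P.IsInvariant σ) {f g : E → ℝ≥0∞} (hf : P.op f = f) (hg : P.op g = g) :
    P.push σ (f + g) = P.push σ f + P.push σ g := by
  funext x
  simp only [push, Pi.add_apply]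
  rw [ENNReal.iSup_add_iSup_of_monotone
    (fun _ _ h => monotone_op_iterate_extend hσ hf h x)
    (fun _ _ h => monotone_op_iterate_extend hσ hg h x)]
  simp only [extend_add, op_iterate_add, Pi.add_apply]

theorem pull_smul (P : SubMatrix E) (σ : E → E) {c : ℝ≥0} (hc : c ≠ 0) (f : E → ℝ≥0∞) :
    P.pull σ ((c : ℝ≥0∞) • f) = (c : ℝ≥0∞) • P.pull σ f := by
  funext x
  simp only [pull, Pi.smul_apply, smul_eq_mul]
  rw [ENNReal.mul_iInf_of_ne (by simpa using hc) ENNReal.coe_ne_top]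
  refine iInf_congr fun n => ?_
  have e : ((c : ℝ≥0∞) • f) ∘ σ = (c : ℝ≥0∞) • (f ∘ σ) := rfl
  rw [e, op_iterate_smul]
  rfl

theorem push_smul (P : SubMatrix E) (σ : E → E) (c : ℝ≥0∞) (f : E → ℝ≥0∞) :
    P.push σ (c • f) = c • P.push σ f := by
  funext x
  simp only [push, Pi.smul_apply, smul_eq_mul, ENNReal.mul_iSup, extend_smul, op_iterate_smul]

theorem push_iSup (P : SubMatrix E) (σ : E → E) {g : ℕ → E → ℝ≥0∞} (hg : Monotone g) :
    P.push σ (fun x => ⨆ k, g k x) = fun x => ⨆ k, P.push σ (g k) x := by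
  funext x
  have e : Function.extend σ (fun x => ⨆ k, g k x) 0
      = fun y => ⨆ k, Function.extend σ (g k) 0 y := by
    funext y
    simp only [Function.extend]
    split_ifs <;> simp
  simp only [push]
  rw [iSup_comm, e]
  refine iSup_congr fun n => ?_
  rw [op_iterate_iSup]
  exact fun a b h => extend_mono σ (hg h)

theorem push_iterate_iSup (P : SubMatrix E) (σ : E → E) (n : ℕ) {g : ℕ → E → ℝ≥0∞}
    (hg : Monotone g) :
    (P.push σ)^[n] (fun x => ⨆ k, g k x) = fun x => ⨆ k, (P.push σ)^[n] (g k) x := by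
  induction n with
  | zero => rfl
  | succ n ih =>
    simp only [Function.iterate_succ_apply', ih]
    exact P.push_iSup σ fun a b h => (P.push_mono σ).iterate n (hg h)

/-- A harmonic function is at most the `pull` of its `push`. -/
theorem le_pull_push (hσ : P.IsInvariant σ) {f : E → ℝ≥0∞} (hf : P.op f = f) :
    f ≤ P.pull σ (P.push σ f) := by
  intro x
  refine le_iInf fun n => ?_
  have h : f ≤ P.push σ f ∘ σ := hσ.extend_le_iff.1 (P.extend_le_push σ f)
  have e : P.op^[n] f = f := Function.iterate_fixed hf n
  calc f x = P.op^[n] f x := by rw [e]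
    _ ≤ _ := P.op_mono.iterate n h x

variable [Countable E]

theorem comp_iterate_le {n : ℕ} {c : ℝ≥0∞} (h : ∀ x, 1 ≤ c * P.hit x (σ^[n] x))
    {f : E → ℝ≥0∞} (hf : P.op f ≤ f) (x : E) : f (σ^[n] x) ≤ c * f x :=
  calc f (σ^[n] x) = 1 * f (σ^[n] x) := (one_mul _).symm
    _ ≤ c * P.hit x (σ^[n] x) * f (σ^[n] x) := by gcongr; exact h x
    _ = c * (P.hit x (σ^[n] x) * f (σ^[n] x)) := mul_assoc _ _ _
    _ ≤ c * f x := by gcongr; exact P.hit_mul_le hf _ _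

theorem le_comp_iterate {n : ℕ} {c : ℝ≥0∞} (h : ∀ x, 1 ≤ c * P.hit (σ^[n] x) x)
    {f : E → ℝ≥0∞} (hf : P.op f ≤ f) (x : E) : f x ≤ c * f (σ^[n] x) :=
  calc f x = 1 * f x := (one_mul _).symm
    _ ≤ c * P.hit (σ^[n] x) x * f x := by gcongr; exact h x
    _ = c * (P.hit (σ^[n] x) x * f x) := mul_assoc _ _ _
    _ ≤ c * f (σ^[n] x) := by gcongr; exact P.hit_mul_le hf _ _

/-- The hitting bounds hold only for large exponents, so one step of `σ` is made as `N + 1` steps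
forward and `N` back, at the cost `2 ^ (N + 1)` and `2 ^ N`. -/
theorem exists_comp_le (hs : P.SlowHitting σ) :
    ∃ c : ℝ≥0, ∀ f : E → ℝ≥0∞, P.op f ≤ f → f ∘ σ ≤ (c : ℝ≥0∞) • f := by
  obtain ⟨N, hN⟩ := (hs 2 one_lt_two).exists_forall_of_atTop
  refine ⟨2 ^ N * 2 ^ (N + 1), fun f hf x => ?_⟩
  have h1 := le_comp_iterate (fun x => (hN N le_rfl x).2) hf (σ x)
  have h2 := comp_iterate_le (fun x => (hN (N + 1) N.le_succ x).1) hf x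
  rw [Function.iterate_succ_apply] at h2
  calc f (σ x) ≤ _ := h1
    _ ≤ _ := mul_le_mul_right h2 _
    _ = _ := by rw [← mul_assoc, ← ENNReal.coe_mul]; rfl

/-- Once at `σⁿ z`, the chain reaches `z` with probability at least `1 / c`. -/
theorem reach_iterate_le (hirr : P.Irreducible) (htrans : P.Transient) {n : ℕ} {c : ℝ≥0∞}
    (h : ∀ x, 1 ≤ c * P.hit (σ^[n] x) x) (x z : E) :
    P.reach x (σ^[n] z) ≤ c * P.reach x z :=
  calc P.reach x (σ^[n] z) = P.reach x (σ^[n] z) * 1 := (mul_one _).symm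
    _ ≤ P.reach x (σ^[n] z) * (c * P.reach (σ^[n] z) z) := by
        gcongr
        exact (h z).trans (mul_le_mul_right (hit_le_reach htrans _ _) _)
    _ = c * (P.reach x (σ^[n] z) * P.reach (σ^[n] z) z) := by ring
    _ ≤ c * P.reach x z := by gcongr; exact reach_mul_reach_le hirr htrans _ _ _

theorem le_reach_iterate (hirr : P.Irreducible) (htrans : P.Transient) {n : ℕ} {c : ℝ≥0∞}
    (h : ∀ x, 1 ≤ c * P.hit x (σ^[n] x)) (x z : E) :
    P.reach x z ≤ c * P.reach x (σ^[n] z) :=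
  calc P.reach x z = P.reach x z * 1 := (mul_one _).symm
    _ ≤ P.reach x z * (c * P.reach z (σ^[n] z)) := by
        gcongr
        exact (h z).trans (mul_le_mul_right (hit_le_reach htrans _ _) _)
    _ = c * (P.reach x z * P.reach z (σ^[n] z)) := by ring
    _ ≤ c * P.reach x (σ^[n] z) := by gcongr; exact reach_mul_reach_le hirr htrans _ _ _

theorem exists_reach_le (hirr : P.Irreducible) (htrans : P.Transient) (hs : P.SlowHitting σ) :
    ∃ c : ℝ≥0, ∀ x z : E, P.reach x (σ z) ≤ c * P.reach x z := by
  obtain ⟨N, hN⟩ := (hs 2 one_lt_two).exists_forall_of_atTop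
  refine ⟨2 ^ N * 2 ^ (N + 1), fun x z => ?_⟩
  have h1 := le_reach_iterate hirr htrans (fun x => (hN N le_rfl x).1) x (σ z)
  have h2 := reach_iterate_le hirr htrans (fun x => (hN (N + 1) N.le_succ x).2) x z
  rw [Function.iterate_succ_apply] at h2
  calc P.reach x (σ z) ≤ _ := h1
    _ ≤ _ := mul_le_mul_right h2 _
    _ = _ := by rw [← mul_assoc, ← ENNReal.coe_mul]

/-- The function `x ↦ reach (σ x) (σ z)` is superharmonic and equals `1` at `z`, so domination
applies. -/
theorem reach_le_reach_map (hirr : P.Irreducible) (htrans : P.Transient) (hσ : P.IsInvariant σ)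
    (x z : E) : P.reach x z ≤ P.reach (σ x) (σ z) := by
  have h := reach_mul_le hirr htrans (hσ.op_comp_le_of_le (P.op_reach_le (σ z)))
    (fun x => reach_ne_top hirr htrans (σ x) (σ z)) x z
  simpa [reach_self htrans] using h

/-- Moving every pole from `z` to `σ z` gives a superharmonic function whose composition with `σ`
dominates the original potential; `push` is the least such majorant. -/
theorem push_iterate_le_tsum (hirr : P.Irreducible) (htrans : P.Transient) (hσ : P.IsInvariant σ)
    (n : ℕ) (ρ : E → ℝ≥0∞) :
    (P.push σ)^[n] (fun x => ∑' z, P.reach x z * ρ z)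
      ≤ fun x => ∑' z, P.reach x (σ^[n] z) * ρ z := by
  induction n with
  | zero => exact le_rfl
  | succ n ih =>
    rw [Function.iterate_succ_apply']
    refine push_le hσ ?_ (ih.trans fun x => ?_)
    · rw [op_tsum]
      intro x
      refine ENNReal.tsum_le_tsum fun z => ?_
      have e : (fun x => P.reach x (σ^[n + 1] z) * ρ z)
          = ρ z • fun x => P.reach x (σ^[n + 1] z) := by
        funext x
        simp [mul_comm]
      rw [e, op_smul, mul_comm]
      exact mul_le_mul_right (P.op_reach_le _ x) _
    · simp only [Function.comp, Function.iterate_succ_apply']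
      gcongr with z
      exact reach_le_reach_map hirr htrans hσ _ _

/-- `push` commutes with increasing limits, so the bound for potentials passes to `f`. -/
theorem push_iterate_le (hirr : P.Irreducible) (htrans : P.Transient) (hσ : P.IsInvariant σ)
    {n : ℕ} {c : ℝ≥0∞} (h : ∀ x z, P.reach x (σ^[n] z) ≤ c * P.reach x z)
    {f : E → ℝ≥0∞} (hf : f ∈ P.harmonicCone) : (P.push σ)^[n] f ≤ c • f := by
  obtain ⟨ρ, hmono, hρ⟩ := exists_charges hirr htrans hf.2.le hf.1
  conv_lhs => rw [hρ]
  rw [push_iterate_iSup _ _ _ hmono]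
  intro x
  refine iSup_le fun k => (push_iterate_le_tsum hirr htrans hσ n (ρ k) x).trans ?_
  calc ∑' z, P.reach x (σ^[n] z) * ρ k z ≤ ∑' z, c * (P.reach x z * ρ k z) := by
        refine ENNReal.tsum_le_tsum fun z => ?_
        rw [← mul_assoc]
        gcongr
        exact h x z
    _ = c * ∑' z, P.reach x z * ρ k z := ENNReal.tsum_mul_left
    _ ≤ c * f x := by
        gcongr
        conv_rhs => rw [hρ]
        exact le_iSup (fun k => ∑' z, P.reach x z * ρ k z) k

theorem isCentral_pull (hσ : P.IsInvariant σ) (hs : P.SlowHitting σ) :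
    P.IsCentral (P.pull σ) where
  op_map f hf := op_pull hσ hf
  add f hf g hg := pull_add hσ hf.2.le hg.2.le
  smul c hc f _ := P.pull_smul σ hc f
  bdd := by
    obtain ⟨c, hc⟩ := exists_comp_le hs
    exact ⟨c, fun f hf => (P.pull_le σ f).trans (hc f hf.2.le)⟩

theorem isCentral_push (hirr : P.Irreducible) (htrans : P.Transient) (hσ : P.IsInvariant σ)
    (hs : P.SlowHitting σ) : P.IsCentral (P.push σ) where
  op_map f hf := op_push hσ hf.2
  add f hf g hg := push_add hσ hf.2 hg.2
  smul c _ f _ := P.push_smul σ c f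
  bdd := by
    obtain ⟨c, hc⟩ := exists_reach_le hirr htrans hs
    exact ⟨c, fun f hf => push_iterate_le hirr htrans hσ (n := 1) hc hf⟩

/-- If the hitting probabilities are slowly varying, a harmonic function `f` is the greatest
harmonic minorant of `f ∘ σ`. -/
theorem pull_eq_self (hirr : P.Irreducible) (htrans : P.Transient) (hσ : P.IsInvariant σ)
    (hs : P.SlowHitting σ) {f : E → ℝ≥0∞} (hf : f ∈ P.harmonicCone) : P.pull σ f = f := by
  refine le_antisymm ?_ ?_
  · refine (isCentral_pull hσ hs).le_self (fun a ha => ?_) f hf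
    filter_upwards [hs a ha] with n hn g hg
    exact (P.pull_iterate_le σ n g).trans (comp_iterate_le (fun x => (hn x).1) hg.2.le)
  · refine (le_pull_push hσ hf.2).trans (P.pull_mono σ ?_)
    refine (isCentral_push hirr htrans hσ hs).le_self (fun a ha => ?_) f hf
    filter_upwards [hs a ha] with n hn g hg
    exact push_iterate_le hirr htrans hσ
      (reach_iterate_le hirr htrans fun x => (hn x).2) hg

end Shift

end SubMatrix
end KilledWalk
end
noncomputable section
namespace KilledWalk
open Topology

/-! ### Exit and killing times -/

section Times

variable {E : Type*} {F : Set E} {ω : ℕ → Option E} {N : ℕ}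

theorem exitTime_eq_coe (hN : 1 ≤ N) (h1 : ω N ∉ some '' F)
    (h2 : ∀ i, 1 ≤ i → i < N → ω i ∈ some '' F) : exitTime F ω = N := by
  classical
  have hl : IsLeast {i : ℕ | 1 ≤ i ∧ ω i ∈ (some '' F)ᶜ} N := by
    refine ⟨⟨hN, h1⟩, fun i hi => ?_⟩
    by_contra h
    exact hi.2 (h2 i hi.1 (not_le.1 h))
  unfold exitTime hittingAfter
  rw [if_pos ⟨N, hN, h1⟩, hl.csInf_eq]
  rfl

theorem exitTime_eq_top (h : ∀ i, 1 ≤ i → ω i ∈ some '' F) : exitTime F ω = ⊤ := by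
  classical
  unfold exitTime hittingAfter
  rw [if_neg]
  rintro ⟨j, h1, h2⟩
  exact h2 (h j h1)

theorem killTime_le (hN : 1 ≤ N) (h : ω N = none) : killTime ω ≤ N := by
  classical
  unfold killTime hittingAfter
  rw [if_pos ⟨N, hN, h⟩]
  have hm : N ∈ {i : ℕ | 1 ≤ i ∧ ω i ∈ ({none} : Set (Option E))} := ⟨hN, h⟩
  exact WithTop.coe_le_coe.2 (Nat.sInf_le hm)

theorem lt_killTime (h : ∀ i, 1 ≤ i → i ≤ N → ω i ≠ none) : (N : WithTop ℕ) < killTime ω := by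
  classical
  unfold killTime hittingAfter
  split_ifs with hj
  · have hm := Nat.sInf_mem (s := {i : ℕ | 1 ≤ i ∧ ω i ∈ ({none} : Set (Option E))}) hj
    refine WithTop.coe_lt_coe.2 ?_
    by_contra hlt
    exact h _ hm.1 (not_lt.1 hlt) hm.2
  · exact WithTop.coe_lt_top N

/-- The paths which leave `F` for the first time at time `n + 1`, into `E`. -/
def firstExit (F : Set E) (n : ℕ) : Set (ℕ → Option E) :=
  {ω | (∀ i < n + 1, ω i ∈ (if i = 0 then Set.univ else some '' F : Set (Option E)))
    ∧ ω (n + 1) ∈ some '' Fᶜ}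

theorem exitTime_of_mem {n : ℕ} (h : ω ∈ firstExit F n) : exitTime F ω = (n + 1 : ℕ) := by
  refine exitTime_eq_coe n.succ_pos ?_ fun i h1 h2 => ?_
  · rintro ⟨x, hx, hx'⟩
    obtain ⟨y, hy, hy'⟩ := h.2
    rw [← hx', Option.some.injEq] at hy'
    exact hy (hy' ▸ hx)
  · have := h.1 i h2
    rwa [if_neg (by omega)] at this

/-- Since `ϑ` lies outside `F`, the exit precedes killing exactly when the first state outside `F`
belongs to `E`. -/
theorem setOf_exitTime_lt_killTime (F : Set E) :
    {ω | exitTime F ω < killTime ω} = ⋃ n, firstExit F n := by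
  classical
  ext ω
  simp only [Set.mem_ofPred_eq, Set.mem_iUnion]
  constructor
  · intro h
    have hex : ∃ i, 1 ≤ i ∧ ω i ∉ some '' F := by
      by_contra hc
      push Not at hc
      rw [exitTime_eq_top hc] at h
      exact not_top_lt h
    obtain ⟨hs1, hs2⟩ := Nat.find_spec hex
    have hmin : ∀ i, 1 ≤ i → i < Nat.find hex → ω i ∈ some '' F := fun i h1 h2 => by
      by_contra hc
      exact Nat.find_min hex h2 ⟨h1, hc⟩
    rw [exitTime_eq_coe hs1 hs2 hmin] at h
    refine ⟨Nat.find hex - 1, ?_⟩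
    have e : Nat.find hex - 1 + 1 = Nat.find hex := Nat.sub_add_cancel hs1
    unfold firstExit
    rw [e]
    refine ⟨fun i hi => ?_, ?_⟩
    · split_ifs with h0
      · trivial
      · exact hmin i (by omega) hi
    · rcases ho : ω (Nat.find hex) with _ | y
      · exact absurd h (not_lt.2 (killTime_le hs1 ho))
      · exact ⟨y, fun hy => hs2 (ho ▸ ⟨y, hy, rfl⟩), rfl⟩
  · rintro ⟨n, h⟩
    rw [exitTime_of_mem h]
    refine lt_killTime fun i h1 h2 hn => ?_
    rcases Nat.lt_or_ge i (n + 1) with h3 | h3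
    · have := h.1 i h3
      rw [if_neg (by omega), hn] at this
      obtain ⟨x, -, hx⟩ := this
      cases hx
    · obtain ⟨x, -, hx⟩ := h.2
      rw [le_antisymm h3 h2, hn] at hx
      cases hx

end Times

/-! ### The chain before its exit from the range of the shift -/

namespace SubMatrix

variable {E : Type*} [Countable E] {P : SubMatrix E} {σ : E → E}

/-- The path starts at `x` almost surely, so any condition at time `0` satisfied by `x` is
immaterial. This reconciles exit times, which start at `1`, with taboo sets constant in time. -/
theorem taboo_congr (P : SubMatrix E) {D D' : ℕ → Set (Option E)} {x : E}
    (h0 : some x ∈ D 0) (h0' : some x ∈ D' 0) (h : ∀ i ≠ 0, D i = D' i) (n : ℕ) (s : Option E) :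
    P.taboo D x n s = P.taboo D' x n s := by
  refine measure_congr ?_
  filter_upwards [P.law_zero x] with ω hω
  refine propext (and_congr_left fun _ => forall₂_congr fun i _ => ?_)
  rcases eq_or_ne i 0 with rfl | hi
  · simp [hω, h0, h0']
  · rw [h i hi]

theorem exitExpectation_eq (P : SubMatrix E) (F : Set E) (h : E → ℝ≥0) {x : E} (hx : x ∈ F) :
    exitExpectation P F h x
      = ∑' n, ∑' w, P.taboo (fun _ => some '' F) x (n + 1) (some w)
          * Fᶜ.indicator (fun w => (h w : ℝ≥0∞)) w := by
  classical
  unfold exitExpectation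
  have hmeas : ∀ n, MeasurableSet (firstExit F n) := fun n =>
    measurableSet_stay (fun i => if i = 0 then Set.univ else some '' F) (n + 1) (some '' Fᶜ)
  rw [setOf_exitTime_lt_killTime, lintegral_iUnion hmeas]
  · refine tsum_congr fun n => ?_
    -- On this event the exit time is `n + 1`, so the default value of `untopD` never occurs.
    have e : ∫⁻ ω in firstExit F n, extendZero h (ω ((exitTime F ω).untopD 0)) ∂(P.law x)
        = ∫⁻ ω in firstExit F n, extendZero h (ω (n + 1)) ∂(P.law x) := by
      refine setLIntegral_congr_fun (hmeas n) fun ω hω => ?_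
      simp only [exitTime_of_mem hω]
      rfl
    rw [e, lintegral_state (P.law x) (measurable_pi_apply (n + 1)), tsum_option_eq]
    simp only [extendZero, mul_zero, zero_add]
    refine tsum_congr fun w => ?_
    by_cases hw : w ∈ F
    · have e0 : {ω | ω ∈ firstExit F n ∧ ω (n + 1) = some w} = ∅ := by
        ext ω
        simp only [Set.mem_ofPred_eq, Set.mem_empty_iff_false, iff_false]
        rintro ⟨h1, h2⟩
        obtain ⟨y, hy, hy'⟩ := h1.2
        rw [h2, Option.some.injEq] at hy'
        exact hy (hy' ▸ hw)
      rw [e0, measure_empty, Set.indicator_of_notMem (by simpa using hw), zero_mul, mul_zero]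
    · rw [Set.indicator_of_mem (by simpa using hw)]
      congr 1
      rw [P.taboo_congr (D := fun _ => some '' F)
        (D' := fun i => if i = 0 then Set.univ else some '' F)
        (Set.mem_image_of_mem some hx) trivial (fun i hi => (if_neg hi).symm)]
      unfold taboo firstExit
      congr 1
      ext ω
      simp only [Set.mem_ofPred_eq]
      constructor
      · rintro ⟨⟨h1, -⟩, h2⟩
        exact ⟨h1, h2⟩
      · rintro ⟨h1, h2⟩
        exact ⟨⟨h1, w, hw, h2.symm⟩, h2⟩
  · intro m n hmn
    refine Set.disjoint_left.2 fun ω h1 h2 => hmn ?_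
    have h3 := (exitTime_of_mem h1).symm.trans (exitTime_of_mem h2)
    have h4 : m + 1 = n + 1 := WithTop.coe_injective h3
    omega

theorem law_succ_eq (P : SubMatrix E) (x y : E) (n : ℕ) :
    P.law x {ω | ω (n + 1) = some y} = ∑' z, P.law x {ω | ω n = some z} * P.p z y := by
  classical
  have e : ∀ n z, P.law x {ω | ω n = some z} = P.taboo (fun _ => Set.univ) x n (some z) := by
    intro n z; simp [taboo]
  simp only [e, taboo_succ_some, Set.mem_univ, if_true]

/-- The chain with transition matrix `P'` started in the range of `σ` and killed when it leaves
that range, if `P'` is the `r`-transform of `P` there. -/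
theorem taboo_range (hσ : Function.Injective σ) {P' : SubMatrix E} {r : E → ℝ≥0∞}
    (hr0 : ∀ x, r x ≠ 0) (hr : ∀ x, r x ≠ ∞)
    (hP : ∀ x y, P'.p (σ x) (σ y) = P.p x y * r y / r x) (x : E) (n : ℕ) :
    (∀ z, P'.taboo (fun _ => some '' Set.range σ) (σ x) n (some (σ z))
      = P.law x {ω | ω n = some z} * (r z / r x)) ∧
    ∀ w, P'.taboo (fun _ => some '' Set.range σ) (σ x) (n + 1) (some w)
      = ∑' v, P.law x {ω | ω n = some v} * (r v / r x) * P'.p (σ v) w := by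
  classical
  have step : ∀ n, (∀ z, P'.taboo (fun _ => some '' Set.range σ) (σ x) n (some (σ z))
      = P.law x {ω | ω n = some z} * (r z / r x)) →
      ∀ w, P'.taboo (fun _ => some '' Set.range σ) (σ x) (n + 1) (some w)
        = ∑' v, P.law x {ω | ω n = some v} * (r v / r x) * P'.p (σ v) w := by
    intro n hn w
    rw [taboo_succ_some, ← hσ.tsum_eq]
    · simp [hn]
    · intro v hv
      by_contra h
      apply hv
      have : ¬ (some v ∈ some '' Set.range σ) := by
        rintro ⟨a, ha, hav⟩
        exact h (Option.some.inj hav ▸ ha)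
      simp only [if_neg this, zero_mul]
  have main : ∀ z, P'.taboo (fun _ => some '' Set.range σ) (σ x) n (some (σ z))
      = P.law x {ω | ω n = some z} * (r z / r x) := by
    induction n with
    | zero =>
      intro z
      have e : P.law x {ω | ω 0 = some z} = P.taboo (fun _ => Set.univ) x 0 (some z) := by
        simp [taboo]
      rw [e, taboo_zero, taboo_zero]
      by_cases hz : z = x
      · subst hz
        simp [ENNReal.div_self (hr0 z) (hr z)]
      · simp [hz, hσ.eq_iff]
    | succ n ih =>
      intro z
      rw [step n ih, law_succ_eq, ← ENNReal.tsum_mul_right]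
      refine tsum_congr fun v => ?_
      rw [hP]
      -- The factors `r v` cancel, so the weights along a path telescope to `r z / r x`.
      have e : r v / r x * (P.p v z * r z / r v) = P.p v z * (r z / r x) := by
        have h1 := ENNReal.mul_inv_cancel (hr0 v) (hr v)
        calc r v / r x * (P.p v z * r z / r v)
            = (r v * (r v)⁻¹) * (P.p v z * (r z / r x)) := by
              simp only [div_eq_mul_inv]; ring
          _ = _ := by rw [h1, one_mul]
      rw [mul_assoc, e, mul_assoc]
  exact ⟨main, step n main⟩

theorem law_stay_eq (P : SubMatrix E) (hσ : Function.Injective σ) (x : E) (n : ℕ) :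
    P.law x {ω | (∀ i < n, ω i ∈ some '' Set.range σ) ∧ ω n ∈ some '' Set.range σ}
      = ∑' z, P.taboo (fun _ => some '' Set.range σ) x n (some (σ z)) := by
  unfold taboo
  rw [← measure_iUnion]
  · congr 1
    ext ω
    simp only [Set.mem_ofPred_eq, Set.mem_iUnion]
    constructor
    · rintro ⟨h1, _, ⟨z, rfl⟩, h2⟩
      exact ⟨z, h1, h2.symm⟩
    · rintro ⟨z, h1, h2⟩
      exact ⟨h1, σ z, ⟨z, rfl⟩, h2.symm⟩
  · intro a b hab
    refine Set.disjoint_left.2 ?_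
    rintro ω ⟨-, h1⟩ ⟨-, h2⟩
    exact hab (hσ (Option.some.inj (h1.symm.trans h2)))
  · intro z
    exact measurableSet_stay (fun _ => some '' Set.range σ) n {some (σ z)}

/-- The probability that the `h`-transform started at `σ x` stays in the range of `σ`. -/
theorem hTransform_law_stay (hσ : P.IsInvariant σ) {h : E → ℝ≥0} (hh : P.IsHarmonic h)
    (hpos : ∀ x, 0 < h x) (x : E) :
    (P.hTransform h hh).law (σ x) {ω | ∀ t : ℕ, ω t ∈ some '' Set.range σ}
      = P.pull σ (fun y => (h y : ℝ≥0∞)) x / h (σ x) := by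
  have hr0 : ∀ y, (h (σ y) : ℝ≥0∞) ≠ 0 := fun y => by simpa using (hpos (σ y)).ne'
  have hr : ∀ y, (h (σ y) : ℝ≥0∞) ≠ ∞ := fun y => ENNReal.coe_ne_top
  set A : ℕ → Set (ℕ → Option E) := fun n =>
    {ω | (∀ i < n, ω i ∈ some '' Set.range σ) ∧ ω n ∈ some '' Set.range σ} with hA
  have e : {ω : ℕ → Option E | ∀ t : ℕ, ω t ∈ some '' Set.range σ} = ⋂ n, A n := by
    ext ω
    simp only [hA, Set.mem_ofPred_eq, Set.mem_iInter]
    exact ⟨fun h n => ⟨fun i _ => h i, h n⟩, fun h n => (h n).2⟩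
  have hanti : Antitone A := antitone_nat_of_succ_le fun n ω hω =>
    ⟨fun i hi => hω.1 i (hi.trans n.lt_succ_self), hω.1 n n.lt_succ_self⟩
  rw [e, hanti.measure_iInter
    (fun n => (measurableSet_stay (fun _ => some '' Set.range σ) n _).nullMeasurableSet)
    ⟨0, measure_ne_top _ _⟩]
  simp only [hA, law_stay_eq _ hσ.injective]
  have h1 : ∀ n, ∑' z, (P.hTransform h hh).taboo (fun _ => some '' Set.range σ) (σ x) n
      (some (σ z)) = P.op^[n] ((fun y => (h y : ℝ≥0∞)) ∘ σ) x * (h (σ x) : ℝ≥0∞)⁻¹ := by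
    intro n
    -- Here `r = h ∘ σ`; invariance turns the `h`-transform on the range of `σ` into the
    -- `r`-transform of `P`.
    have h2 := (taboo_range (P := P) (P' := P.hTransform h hh) hσ.injective hr0 hr
      (fun y z => by simp only [hTransform, hσ.p_map]) x n).1
    simp only [h2, div_eq_mul_inv, ← mul_assoc]
    rw [ENNReal.tsum_mul_right, ← tsum_law_mul]
    rfl
  simp only [h1, pull, div_eq_mul_inv]
  rw [ENNReal.iInf_mul_of_ne (ENNReal.inv_ne_zero.2 (hr x)) (ENNReal.inv_ne_top.2 (hr0 x))]

/-- Irreducibility gives `h x ≥ ℙ_x(X(t) = y) h y > 0` for a point `y` with `h y ≠ 0` and a suitable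
`t`. -/
theorem IsHarmonic.pos {h : E → ℝ≥0} (hh : P.IsHarmonic h) (hirr : P.Irreducible) (x : E) :
    0 < h x := by
  obtain ⟨y, hy⟩ := Function.ne_iff.1 hh.ne_zero
  obtain ⟨t, ht⟩ := hirr x y
  have h1 := P.op_iterate_le hh.mem_harmonicCone.2.le t x
  rw [← tsum_law_mul] at h1
  have h2 := (ENNReal.le_tsum y).trans h1
  rw [← ENNReal.coe_pos]
  refine lt_of_lt_of_le (ENNReal.mul_pos ht.ne' ?_) h2
  simpa using hy

end SubMatrix

/-! ### Translations of the group -/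

section Translation

variable {𝓔 : Type*} [Group 𝓔] {E : Set 𝓔} {u : 𝓔}

theorem shift_injective (hE : TranslateSubset E u) : Function.Injective (shift hE) := by
  intro x y h
  exact Subtype.ext (mul_right_cancel (congrArg Subtype.val h))

theorem shift_pow (hE : TranslateSubset E u) (n : ℕ) : shift (hE.pow n) = (shift hE)^[n] := by
  induction n with
  | zero => funext x; exact Subtype.ext (by simp [shift])
  | succ n ih =>
    funext x
    rw [Function.iterate_succ_apply', ← ih]
    exact Subtype.ext (by simp [shift, pow_succ, mul_assoc])

theorem isInvariant_shift {P : SubMatrix E} {hE : TranslateSubset E u}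
    (hinv : ∀ x y : E, P.p (shift hE x) (shift hE y) = P.p x y) : P.IsInvariant (shift hE) :=
  ⟨shift_injective hE, hinv⟩

/-- Exponentiating `log q > -n log a`. The case `q = 0` is excluded because `log 0 = -∞` has
infinite absolute value. -/
theorem one_le_pow_mul_of_abs_log_lt {a : ℝ≥0} (ha : 1 < a) {n : ℕ} (hn : 0 < n) {q : ℝ≥0∞}
    (h : (ENNReal.log q / (n : EReal)).abs < ENNReal.ofReal (Real.log a)) :
    1 ≤ ((a ^ n : ℝ≥0) : ℝ≥0∞) * q := by
  have ha0 : (0 : ℝ) < a := by exact_mod_cast zero_lt_one.trans ha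
  have hn0 : (0 : ℝ) < n := by exact_mod_cast hn
  rcases eq_or_ne q 0 with rfl | h0
  · rw [ENNReal.log_zero, EReal.bot_div_of_pos_ne_top (by exact_mod_cast hn)
      (EReal.natCast_ne_top n), EReal.abs_bot] at h
    exact absurd h not_top_lt
  rcases eq_or_ne q ∞ with rfl | ht
  · rw [ENNReal.mul_top (by simpa using fun h => absurd h (zero_lt_one.trans ha).ne')]
    exact le_top
  rw [ENNReal.log_pos_real h0 ht] at h
  have e : ((Real.log q.toReal : ℝ) : EReal) / (n : EReal)
      = ((Real.log q.toReal / n : ℝ) : EReal) := by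
    rw [EReal.coe_div]
    rfl
  rw [e, EReal.abs_def, ENNReal.ofReal_lt_ofReal_iff (Real.log_pos (by exact_mod_cast ha)),
    abs_lt, lt_div_iff₀ hn0] at h
  have h1 := h.1
  lift q to ℝ≥0 using ht
  have hq : (0 : ℝ) < q := by
    have : q ≠ 0 := by simpa using h0
    positivity
  have h2 : 0 ≤ Real.log ((a : ℝ) ^ n * q) := by
    rw [Real.log_mul (by positivity) hq.ne', Real.log_pow]
    simp only [ENNReal.coe_toReal] at h1
    linarith
  have h3 : (1 : ℝ) ≤ (a : ℝ) ^ n * q := by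
    by_contra hc
    exact absurd h2 (not_le.2 (Real.log_neg (by positivity) (not_le.1 hc)))
  exact_mod_cast h3

theorem SlowlyVarying.slowHitting {P : SubMatrix E} {hE : TranslateSubset E u}
    (h : SlowlyVarying P hE) : P.SlowHitting (shift hE) := by
  intro a ha
  filter_upwards [h (Real.log a) (Real.log_pos (by exact_mod_cast ha)), eventually_gt_atTop 0]
    with n hn hn0 x
  have := hn x
  rw [shift_pow hE] at this
  exact ⟨one_le_pow_mul_of_abs_log_lt ha hn0 this.1, one_le_pow_mul_of_abs_log_lt ha hn0 this.2⟩

/-- Invariance makes the difference vanish for `y ∈ E ⋆ u`; only steps out of `E ⋆ u` survive. -/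
theorem aMatrix_eq_indicator (P : SubMatrix E) (hE : TranslateSubset E u)
    (hinv : ∀ x y : E, P.p (shift hE x) (shift hE y) = P.p x y) (x y : E) :
    aMatrix P hE x y = (translate hE)ᶜ.indicator (fun y => P.p (shift hE x) y) y := by
  unfold aMatrix
  split_ifs with hy
  · have e : shift hE ⟨y * u⁻¹, hy⟩ = y := Subtype.ext (by simp [shift])
    rw [Set.indicator_of_notMem (by simpa using ⟨_, e⟩), ← hinv x, e, tsub_self]
  · rw [Set.indicator_of_mem]
    rintro ⟨z, rfl⟩
    exact hy (by simp [shift])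

theorem greenOp_aOp (P : SubMatrix E) [Countable E] (hE : TranslateSubset E u)
    (hinv : ∀ x y : E, P.p (shift hE x) (shift hE y) = P.p x y) (h : E → ℝ≥0) (y : E) :
    P.greenOp (aOp P hE (fun z => (h z : ℝ≥0∞))) y
      = exitExpectation P (translate hE) h (shift hE y) := by
  rw [P.exitExpectation_eq (translate hE) h ⟨y, rfl⟩, SubMatrix.greenOp_eq]
  refine tsum_congr fun n => ?_
  -- With `r = 1` the killed chain is an exact copy of the original one: the `n`-th term of the
  -- Green series is the contribution of an exit at time `n + 1`.
  have h1 := (SubMatrix.taboo_range (P := P) (P' := P) (r := 1) (shift_injective hE)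
    (by simp) (by simp) (by simp [hinv]) y n).2
  simp only [translate] at h1 ⊢
  simp only [h1, ← SubMatrix.tsum_law_mul, aOp, aMatrix_eq_indicator P hE hinv,
    ← ENNReal.tsum_mul_left, ← ENNReal.tsum_mul_right]
  rw [ENNReal.tsum_comm]
  refine tsum_congr fun w => tsum_congr fun v => ?_
  by_cases hw : w ∈ Set.range (shift hE)
  · rw [Set.indicator_of_notMem (by simpa [translate] using hw),
      Set.indicator_of_notMem (by simpa using hw)]
    simp
  · rw [Set.indicator_of_mem (by simpa [translate] using hw),
      Set.indicator_of_mem (by simpa using hw)]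
    simp [mul_assoc]

end Translation

end KilledWalk
end

open KilledWalk
theorem mainTheorem8 {𝓔 : Type*} [Group 𝓔] (E : Set 𝓔) (hcount : E.Countable)
    (P : SubMatrix E) (hirr : P.Irreducible) (htrans : P.Transient)
    (u : 𝓔) (hu : u ∈ E) (hE : TranslateSubset E u)
    (hinv : ∀ x y : E, P.p (shift hE x) (shift hE y) = P.p x y) :
    (∀ (h : E → ℝ≥0) (y : E),
      P.greenOp (aOp P hE (fun z => (h z : ℝ≥0∞))) y
        = exitExpectation P (translate hE) h (shift hE y)) ∧
    (SlowlyVarying P hE →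
      ∀ (h : E → ℝ≥0) (hh : P.IsHarmonic h),
        (∀ x, 0 < h x) ∧
        ∀ x : E, (h x : ℝ≥0∞) / (h (shift hE x) : ℝ≥0∞)
          = (P.hTransform h hh).law (shift hE x)
              {ω | ∀ t : ℕ, ω t ∈ some '' translate hE}) := by
  have : Countable E := hcount.to_subtype
  have hσ := isInvariant_shift hinv
  refine ⟨fun h y => greenOp_aOp P hE hinv h y, fun hs h hh => ?_⟩
  have hpos := fun x => hh.pos hirr x
  refine ⟨hpos, fun x => ?_⟩
  have h1 := SubMatrix.hTransform_law_stay hσ hh hpos x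
  rw [SubMatrix.pull_eq_self hirr htrans hσ hs.slowHitting hh.mem_harmonicCone] at h1
  exact h1.symm
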